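/- Let $d\ge 2$ be an integer, $p>2$, $\frac1p+\frac1{p'}=1$, $\varepsilon>0$, $\beta\in\mathbb R$, and let $N,m\ge 0$ be integers and $r,s>0$. For $\zeta,\delta\in\mathbb C$ and integers $j,k\ge0$ put $$\delta(\zeta)=\tfrac{d-1}{2}+\zeta,\qquad \lambda(\zeta)=\tfrac d2+\zeta-1,\qquad A_j^{\delta}=\frac{\Gamma(j+\delta+1)}{\Gamma(j+1)\Gamma(\delta+1)},\qquad C_D=\frac{4\pi^{(D-1)/2}}{\Gamma((D-1)/2)},$$ and let $\binom{x}{k}=x(x-1)\cdots(x-k+1)/k!$. *Laguerre side.* For $\operatorname{Re}\alpha>-1$ let $$L_k^\alpha(x)=\sum_{j=0}^k\frac{\Gamma(k+\alpha+1)}{\Gamma(j+\alpha+1)}\frac{(-x)^j}{j!\,(k-j)!},\qquad \psi_k^\alpha(r)=\Big(\frac{2\Gamma(k+1)}{\Gamma(k+\alpha+1)}\Big)^{1/2}L_k^\alpha(r^2)e^{-r^2/2},$$ and define $$K_{N,m}^{\delta,\zeta}(r,s)=\frac1{A_N^\delta}\sum_{j=0}^{[(N-m)/2]}A_{N-m-2j}^\delta\,(rs)^m\,\psi_j^{\lambda(\zeta)+m}(r)\,\psi_j^{\lambda(\zeta)+m}(s)\quad(N\ge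 m),\qquad K_{N,m}^{\delta,\zeta}=0\quad(N<m),$$ $$\mathcal K_{N,m}^{\varepsilon,\zeta}(r,s)=r^{2\delta(\zeta)/p}\,s^{2\delta(\zeta)/p'}\,K_{N,m}^{\delta(\zeta+\varepsilon),\zeta}(r,s).$$ *Hermite side.* For $D\in\{d,d+1\}$ let $\Phi_\mu$, $\mu\in\mathbb N^D$, be the $L^2$-normalized Hermite functions on $\mathbb R^D$, let $\Phi_j(x,y)=\sum_{|\mu|=j}\Phi_\mu(x)\Phi_\mu(y)$, and let $$\sigma_n^{\delta,D}(x,y)=\frac1{A_n^\delta}\sum_{j=0}^nA_{n-j}^\delta\,\Phi_j(x,y)$$ be the Cesàro kernel of complex order $\delta$. *The functions $Q$.* For real $a>-\frac12$ let $P_m^a$ be the ultraspherical polynomial of type $a$ and degree $m$ normalized by $P_m^a(1)=1$ (the Chebyshev polynomial $T_m$ if $a=0$). For $\lambda=a+ib$, $\eta>0$ and $u\in[-1,1]$ let $$Q_m^{\lambda,\eta}(u)=\frac1{\Gamma(ib+\eta)}\int_{|u|}^1P_m^a\Big(\frac us\Big)(s^2-u^2)^{a-1/2}(1-s^2)^{ib+\eta-1}s^{m+1}\,ds,\qquad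 Q_m^\lambda(u)=\lim_{\eta\to0^+}Q_m^{\lambda,\eta}(u).$$ Then $\sigma_n^{\delta,D}(rx',sy')$, for unit vectors $x',y'\in\mathbb R^D$, depends only on $r$, $s$ and $u=x'\cdot y'$, and it is written $\sigma_n^{\delta,D}(r,s;u)$; the limits $Q_m^{\lambda(i\beta)}(u)$ and $Q_m^{\lambda(\frac12+i\beta)}(u)$ exist for all $u\in[-1,1]$; the integrands below are integrable on $[-1,1]$; and $$\mathcal K_{N,m}^{\varepsilon,i\beta}(r,s)=\frac{C_d}{A_N^{\delta(i\beta+\varepsilon)}}\sum_{k=0}^N\binom{\varepsilon/2}{N-k}\sum_{j=0}^{[k/2]}A_j^{\frac\varepsilon2+i\beta-1}A_{k-2j}^{\delta(i\beta+\frac\varepsilon2)}\,r^{\frac{2\delta(i\beta)}p}s^{\frac{2\delta(i\beta)}{p'}}\int_{-1}^1\sigma_{k-2j}^{\delta(i\beta+\frac\varepsilon2),d}(r,s;u)\,Q_m^{\lambda(i\beta)}(u)\,du,$$ $$\mathcal K_{N,m}^{\varepsilon,\frac12+i\beta}(r,s)=\frac{C_{d+1}}{A_N^{\delta(\frac12+i\beta+\varepsilon)}}\sum_{k=0}^N\binom{\varepsilon/2}{N-k}\sum_{j=0}^{[k/2]}A_j^{\frac\varepsilon2+i\beta-1}A_{k-2j}^{\delta(\frac12+i\beta+\frac\varepsilon2)}\,r^{\frac{2\delta(\frac12+i\beta)}p}s^{\frac{2\delta(\frac12+i\beta)}{p'}}\int_{-1}^1\sigma_{k-2j}^{\delta(\frac12+i\beta+\frac\varepsilon2),d+1}(r,s;u)\,Q_m^{\lambda(\frac12+i\beta)}(u)\,du.$$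 -/

import Mathlib

open Filter Topology MeasureTheory Polynomial

noncomputable section

namespace CesaroHermite

/-- `δ(ζ) = (d - 1)/2 + ζ`. -/
def deltaParam (d : ℕ) (ζ : ℂ) : ℂ := ((d : ℂ) - 1) / 2 + ζ

/-- `λ(ζ) = d/2 + ζ - 1`. -/
def lambdaParam (d : ℕ) (ζ : ℂ) : ℂ := (d : ℂ) / 2 + ζ - 1

/-- The binomial numbers `A_j^δ = Γ(j + δ + 1) / (Γ(j + 1) Γ(δ + 1))` of complex order `δ`. -/
def cesaroNumber (δ : ℂ) (j : ℕ) : ℂ :=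
  Complex.Gamma ((j : ℂ) + δ + 1) / (Complex.Gamma ((j : ℂ) + 1) * Complex.Gamma (δ + 1))

/-- The constant `C_D = 4 π^((D - 1)/2) / Γ((D - 1)/2)`. -/
def constC (D : ℕ) : ℝ :=
  4 * Real.pi ^ (((D : ℝ) - 1) / 2) / Real.Gamma (((D : ℝ) - 1) / 2)

/-! ### Hermite functions and Hermite Cesàro kernels -/

/-- The `n`-th `L²(ℝ)`-normalized Hermite function
`h_n(x) = (2^n n! √π)^(-1/2) H_n(x) e^(-x²/2)`. Mathlib's `hermite n` is the probabilists' Hermite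
polynomial, and `H_n(x) = 2^(n/2) * hermite n (√2 x)`. -/
def hermiteFun (n : ℕ) (x : ℝ) : ℝ :=
  aeval (√2 * x) (hermite n) * Real.exp (-x ^ 2 / 2) / √((n.factorial : ℝ) * √Real.pi)

/-- The Hermite function `Φ_μ` on `ℝ^D` with multi-index `μ`. -/
def hermiteFunction (D : ℕ) (μ : Fin D → ℕ) (x : EuclideanSpace ℝ (Fin D)) : ℝ :=
  ∏ i, hermiteFun (μ i) (x i)

/-- The kernel `Φ_j(x, y) = ∑_{|μ| = j} Φ_μ(x) Φ_μ(y)` of the `j`-th Hermite projection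
on `ℝ^D`. -/
def hermiteProjKernel (D j : ℕ) (x y : EuclideanSpace ℝ (Fin D)) : ℝ :=
  ∑ μ ∈ Finset.piAntidiag (Finset.univ : Finset (Fin D)) j,
    hermiteFunction D μ x * hermiteFunction D μ y

/-- The `D`-dimensional Hermite Cesàro kernel `σ_N^{δ,D}(x, y)` of complex order `δ`. -/
def hermiteCesaroKernel (D : ℕ) (δ : ℂ) (N : ℕ) (x y : EuclideanSpace ℝ (Fin D)) : ℂ :=
  1 / cesaroNumber δ N *
    ∑ j ∈ Finset.range (N + 1), cesaroNumber δ (N - j) * (hermiteProjKernel D j x y : ℂ)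

/-- `σ_N^{δ,D}(r, s; u)`: the Cesàro kernel `σ_N^{δ,D}(r x', s y')`, where `x'`, `y'` are unit
vectors of `ℝ^D` (`D ≥ 2`) with `x' ⬝ y' = u ∈ [-1, 1]`. The representatives chosen here are
`x' = (1, 0, …, 0)` and `y' = (u, √(1 - u²), 0, …, 0)`. -/
def radialCesaroKernel (D : ℕ) (δ : ℂ) (N : ℕ) (r s u : ℝ) : ℂ :=
  hermiteCesaroKernel D δ N
    (r • WithLp.toLp 2 (fun i : Fin D => if (i : ℕ) = 0 then 1 else 0))
    (s • WithLp.toLp 2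
      (fun i : Fin D => if (i : ℕ) = 0 then u else if (i : ℕ) = 1 then √(1 - u ^ 2) else 0))

/-! ### Laguerre functions of complex type and the weighted kernels -/

/-- The Laguerre polynomial
`L_k^α(x) = ∑_{j ≤ k} Γ(k + α + 1) / Γ(j + α + 1) * (-x)^j / (j! (k - j)!)`
of complex type `α`, `Re α > -1`. -/
def laguerrePoly (α : ℂ) (k : ℕ) (x : ℝ) : ℂ :=
  ∑ j ∈ Finset.range (k + 1),
    Complex.Gamma ((k : ℂ) + α + 1) / Complex.Gamma ((j : ℂ) + α + 1) *
      (-(x : ℂ)) ^ j / ((j.factorial : ℂ) * ((k - j).factorial : ℂ))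

/-- The normalized Laguerre function
`ψ_k^α(r) = (2 Γ(k + 1) / Γ(k + α + 1))^(1/2) L_k^α(r²) e^(-r²/2)` of complex type `α`,
`Re α > -1`. -/
def laguerreFun (α : ℂ) (k : ℕ) (r : ℝ) : ℂ :=
  (2 * Complex.Gamma ((k : ℂ) + 1) / Complex.Gamma ((k : ℂ) + α + 1)) ^ (1 / 2 : ℂ) *
    laguerrePoly α k (r ^ 2) * (Real.exp (-r ^ 2 / 2) : ℂ)

/-- The kernel `K_{N,m}^{δ,ζ}(r, s)` for complex `δ` and `ζ`, in terms of Laguerre functions of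
type `λ(ζ) + m`; it is `0` for `N < m`. -/
def kernelK (d N m : ℕ) (δ ζ : ℂ) (r s : ℝ) : ℂ :=
  if m ≤ N then
    1 / cesaroNumber δ N *
      ∑ j ∈ Finset.range ((N - m) / 2 + 1),
        cesaroNumber δ (N - m - 2 * j) * ((r * s : ℝ) : ℂ) ^ m *
          laguerreFun (lambdaParam d ζ + m) j r * laguerreFun (lambdaParam d ζ + m) j s
  else 0

/-- The weighted kernel
`𝒦_{N,m}^{ε,ζ}(r, s) = r^(2δ(ζ)/p) s^(2δ(ζ)/p') K_{N,m}^{δ(ζ+ε),ζ}(r, s)`. -/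
def weightedKernel (d : ℕ) (p p' ε : ℝ) (N m : ℕ) (ζ : ℂ) (r s : ℝ) : ℂ :=
  (r : ℂ) ^ (2 * deltaParam d ζ / (p : ℂ)) * (s : ℂ) ^ (2 * deltaParam d ζ / (p' : ℂ)) *
    kernelK d N m (deltaParam d (ζ + ε)) ζ r s

/-! ### Ultraspherical polynomials and the functions `Q_m^λ` -/

/-- The ultraspherical polynomial `P_m^a` of type `a > -1/2`, normalized by `P_m^a(1) = 1`, through
its three-term recurrence
`(m + 1 + 2a) P_{m+2}(u) = 2 (m + 1 + a) u P_{m+1}(u) - (m + 1) P_m(u)`.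
For `a ≠ 0` it is `C_m^a(u) / C_m^a(1)` with the Gegenbauer polynomial `C_m^a`, and for `a = 0` it
is the Chebyshev polynomial `T_m`. -/
def ultraspherical (a : ℝ) : ℕ → ℝ → ℝ
  | 0, _ => 1
  | 1, u => u
  | m + 2, u =>
      (2 * ((m : ℝ) + 1 + a) * u * ultraspherical a (m + 1) u -
        ((m : ℝ) + 1) * ultraspherical a m u) / ((m : ℝ) + 1 + 2 * a)

/-- For `λ = a + i b`, `ε > 0` and `-1 ≤ u ≤ 1`,
`Q_m^{λ,ε}(u) = Γ(i b + ε)⁻¹ *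
  ∫_{|u|}^1 P_m^a(u / s) (s² - u²)^(a - 1/2) (1 - s²)^(i b + ε - 1) s^(m + 1) ds`. -/
def regQ (m : ℕ) (lam : ℂ) (ε u : ℝ) : ℂ :=
  1 / Complex.Gamma (lam.im * Complex.I + ε) *
    ∫ s in Set.Icc |u| 1,
      ((ultraspherical lam.re m (u / s) * (s ^ 2 - u ^ 2) ^ (lam.re - 1 / 2) : ℝ) : ℂ) *
        ((1 - s ^ 2 : ℝ) : ℂ) ^ (lam.im * Complex.I + ε - 1) * (s : ℂ) ^ (m + 1)

/-- `Q_m^λ(u) = lim_{ε → 0+} Q_m^{λ,ε}(u)`. -/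
def funQ (m : ℕ) (lam : ℂ) (u : ℝ) : ℂ :=
  limUnder (𝓝[>] (0 : ℝ)) fun ε => regQ m lam ε u

end CesaroHermite

end

/-!
Both kernel formulas are one statement about a dimension `D`, equal to `d` or `d + 1`: in either
case `λ = λ(ζ) = D / 2 - 1 + b` and `δ = δ(ζ) = (D - 1) / 2 + b` with `b = i β`. The statement `weightedKernel_eq` compares the coefficients of `t^N` in an
identity of formal power series. With `I(t) = ∑ t^i ∫ Φ_i(r, s; u) Q_m^λ(u) du`, the double sum on
the right has the generating series
`(1 + t)^(ε/2) (1 - t²)^(-ε/2 - b) (1 - t)^(-δ - ε/2 - 1) I(t)`, and `binomialSeries_mul_negPow`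
turns it into `(1 - t)^(-δ - ε - 1) (1 - t²)^(-b) I(t)`. It remains to see that `(1 - t²)^(-b) I(t)`
is, up to the constant `C_D`, the series of products of Laguerre functions of type `α = λ + m`; this
is `expand_negPow_mul_projIntegral`. It rests on three facts.

* Mehler's formula (`hermiteProjKernel_eq_sum`) expands `Φ_i` in powers of `x ⬝ y`, with Laguerre
  polynomials of `|x|² + |y|²` of types `D / 2 - 1 + k` as coefficients. It shows in particular that
  the Cesàro kernels depend only on the norms and the inner product. It is proved by a first-order
  differential equation in `t`, which both sides satisfy as formal power series.
* The substitution `s² = u² + (1 - u²) v` turns the integral defining `Q_m^{λ,η}` into Beta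
  integrals. As the coefficients of ultraspherical polynomials in powers of `u` and `1 - u²` have the matching
  Pochhammer form, the outcome (`regQ_eq`) is a constant times `(1 - u²)^(ν - 1/2) P_m^ν(u)` with
  `ν = λ + η`, where `P_m^ν` is the ultraspherical polynomial of *complex* type `ν`. So the limit
  `η → 0+` exists and is integrable, and repeated integration by parts gives its moments
  (`gegenbauerMoment_even` and the vanishing of the others).
* Inserting the moments into Mehler's formula leaves
  `∑_l (r s)^(2 l) L_{q - l}^{α + 2 l}(r² + s²) / (l! Γ(l + α + 1))`, where the factor
  `(1 - t²)^(-b)` has shifted the types by `b`. By the product formula `laguerre_product` this is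
  `q! / Γ(q + α + 1) L_q^α(r²) L_q^α(s²)`; that formula holds because the Laguerre operator in the
  first variable telescopes along the sum, and a polynomial solution of the Laguerre equation is
  determined by its value at `0`.
-/

noncomputable section

namespace CesaroHermite

/-! ### Formal power series and first-order linear equations -/

/-- A formal power series over `ℂ` is determined by its logarithmic derivative and its constant
coefficient. -/
theorem powerSeries_eq_of_logDeriv_eq {F G L : PowerSeries ℂ}
    (hF : PowerSeries.derivative ℂ F = L * F) (hG : PowerSeries.derivative ℂ G = L * G)
    (h0 : PowerSeries.constantCoeff F = PowerSeries.constantCoeff G) : F = G := by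
  ext n
  induction n using Nat.strong_induction_on with
  | _ n ih =>
    cases n with
    | zero => simpa using h0
    | succ n =>
      have e1 := congrArg (PowerSeries.coeff n) hF
      have e2 := congrArg (PowerSeries.coeff n) hG
      rw [PowerSeries.coeff_derivative, PowerSeries.coeff_mul] at e1 e2
      have hs : ∑ p ∈ Finset.HasAntidiagonal.antidiagonal n,
          PowerSeries.coeff p.1 L * PowerSeries.coeff p.2 F =
          ∑ p ∈ Finset.HasAntidiagonal.antidiagonal n,
            PowerSeries.coeff p.1 L * PowerSeries.coeff p.2 G := by
        refine Finset.sum_congr rfl fun p hp => ?_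
        rw [ih p.2 (by have := Finset.HasAntidiagonal.mem_antidiagonal.1 hp; omega)]
      have hn : ((n : ℂ) + 1) ≠ 0 := Nat.cast_add_one_ne_zero n
      exact mul_right_cancel₀ hn (by rw [e1, e2, hs])

theorem logDeriv_mul {F G L M : PowerSeries ℂ}
    (hF : PowerSeries.derivative ℂ F = L * F) (hG : PowerSeries.derivative ℂ G = M * G) :
    PowerSeries.derivative ℂ (F * G) = (L + M) * (F * G) := by
  rw [Derivation.leibniz, hF, hG, smul_eq_mul, smul_eq_mul]
  ring

theorem logDeriv_prod {ι : Type*} (s : Finset ι) {F L : ι → PowerSeries ℂ}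
    (hF : ∀ i ∈ s, PowerSeries.derivative ℂ (F i) = L i * F i) :
    PowerSeries.derivative ℂ (∏ i ∈ s, F i) = (∑ i ∈ s, L i) * ∏ i ∈ s, F i := by
  classical
  induction s using Finset.induction_on with
  | empty => simp
  | insert i s hi ih =>
    rw [Finset.prod_insert hi, Finset.sum_insert hi]
    exact logDeriv_mul (hF i (by simp)) (ih fun j hj => hF j (by simp [hj]))

/-- The number `c (c + 1) ⋯ (c + n - 1) / n!`. -/
def risingCoeff (c : ℂ) (n : ℕ) : ℂ := (ascPochhammer ℂ n).eval c / (n.factorial : ℂ)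

theorem risingCoeff_zero (c : ℂ) : risingCoeff c 0 = 1 := by simp [risingCoeff]

theorem succ_mul_risingCoeff (c : ℂ) (n : ℕ) :
    ((n : ℂ) + 1) * risingCoeff c (n + 1) = (c + n) * risingCoeff c n := by
  have h1 : ((n : ℂ) + 1) ≠ 0 := Nat.cast_add_one_ne_zero n
  have h2 : (n.factorial : ℂ) ≠ 0 := Nat.cast_ne_zero.2 n.factorial_ne_zero
  rw [risingCoeff, risingCoeff, ascPochhammer_succ_eval, Nat.factorial_succ]
  push_cast
  field_simp

/-- The formal power series `(1 - X)^(-c)`. -/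
def negPow (c : ℂ) : PowerSeries ℂ := PowerSeries.mk (risingCoeff c)

theorem coeff_negPow (c : ℂ) (n : ℕ) : PowerSeries.coeff n (negPow c) = risingCoeff c n :=
  PowerSeries.coeff_mk _ _

theorem constantCoeff_negPow (c : ℂ) : PowerSeries.constantCoeff (negPow c) = 1 := by
  rw [← PowerSeries.coeff_zero_eq_constantCoeff_apply, coeff_negPow, risingCoeff_zero]

/-- The geometric series in `X²`, the inverse of `1 - X²`. -/
def geomSq : PowerSeries ℂ := PowerSeries.expand 2 two_ne_zero (negPow 1)

theorem derivative_negPow_aux (c : ℂ) :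
    (1 - PowerSeries.X) * PowerSeries.derivative ℂ (negPow c) = PowerSeries.C c * negPow c := by
  ext n
  rw [sub_mul, one_mul, map_sub, PowerSeries.coeff_derivative, PowerSeries.coeff_C_mul,
    coeff_negPow, coeff_negPow]
  have h := succ_mul_risingCoeff c n
  cases n with
  | zero => simp at h ⊢; simpa [risingCoeff_zero] using h
  | succ n =>
    rw [PowerSeries.coeff_succ_X_mul, PowerSeries.coeff_derivative, coeff_negPow]
    push_cast at h ⊢
    linear_combination h

theorem one_sub_mul_negPow_one : (1 - PowerSeries.X) * negPow 1 = 1 := by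
  ext n
  rw [sub_mul, one_mul, map_sub]
  have h1 : ∀ n, risingCoeff 1 n = 1 := by
    intro n
    induction n with
    | zero => exact risingCoeff_zero _
    | succ n ih =>
      have h := succ_mul_risingCoeff 1 n
      rw [ih] at h
      have hn : ((n : ℂ) + 1) ≠ 0 := Nat.cast_add_one_ne_zero n
      exact mul_left_cancel₀ hn (by rw [h]; ring)
  cases n with
  | zero => simp [coeff_negPow, h1, constantCoeff_negPow]
  | succ n => simp [PowerSeries.coeff_succ_X_mul, coeff_negPow, h1, PowerSeries.coeff_one]

theorem one_sub_sq_mul_geomSq : (1 - PowerSeries.X ^ 2) * geomSq = 1 := by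
  have h := congrArg (PowerSeries.expand 2 two_ne_zero) one_sub_mul_negPow_one
  rwa [map_mul, map_sub, map_one, PowerSeries.expand_X] at h

theorem negPow_one_eq : negPow 1 = (1 + PowerSeries.X) * geomSq := by
  linear_combination (-negPow 1) * one_sub_sq_mul_geomSq +
    (1 + PowerSeries.X) * geomSq * one_sub_mul_negPow_one

theorem derivative_negPow' (c : ℂ) :
    PowerSeries.derivative ℂ (negPow c) = PowerSeries.C c * negPow 1 * negPow c := by
  linear_combination negPow 1 * derivative_negPow_aux c -
    PowerSeries.derivative ℂ (negPow c) * one_sub_mul_negPow_one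

theorem derivative_negPow (c : ℂ) :
    PowerSeries.derivative ℂ (negPow c) =
      PowerSeries.C c * ((1 + PowerSeries.X) * geomSq) * negPow c := by
  rw [derivative_negPow', negPow_one_eq]

theorem negPow_mul (b c : ℂ) : negPow b * negPow c = negPow (b + c) := by
  refine powerSeries_eq_of_logDeriv_eq
    (logDeriv_mul (derivative_negPow' b) (derivative_negPow' c)) (L := _) ?_ ?_
  · rw [derivative_negPow', map_add, add_mul]
  · simp [constantCoeff_negPow]

theorem derivative_expand_two (F : PowerSeries ℂ) :
    PowerSeries.derivative ℂ (PowerSeries.expand 2 two_ne_zero F) =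
      2 * PowerSeries.X * PowerSeries.expand 2 two_ne_zero (PowerSeries.derivative ℂ F) := by
  rw [PowerSeries.expand_apply, PowerSeries.expand_apply,
    PowerSeries.derivative_subst (PowerSeries.HasSubst.X_pow two_ne_zero),
    PowerSeries.derivative_pow, PowerSeries.derivative_X]
  push_cast
  ring

theorem derivative_expand_negPow (c : ℂ) :
    PowerSeries.derivative ℂ (PowerSeries.expand 2 two_ne_zero (negPow c)) =
      PowerSeries.C c * (2 * PowerSeries.X * geomSq) *
        PowerSeries.expand 2 two_ne_zero (negPow c) := by
  rw [derivative_expand_two, derivative_negPow', map_mul, map_mul, PowerSeries.expand_C, ← geomSq]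
  ring

theorem derivative_geomSq :
    PowerSeries.derivative ℂ geomSq = 2 * PowerSeries.X * geomSq ^ 2 := by
  rw [geomSq, derivative_expand_negPow, map_one, ← geomSq]
  ring

theorem derivative_binomialSeries (c : ℂ) :
    PowerSeries.derivative ℂ (PowerSeries.binomialSeries ℂ c) =
      PowerSeries.C c * ((1 - PowerSeries.X) * geomSq) * PowerSeries.binomialSeries ℂ c := by
  have h : (1 + PowerSeries.X) * PowerSeries.derivative ℂ (PowerSeries.binomialSeries ℂ c) =
      PowerSeries.C c * PowerSeries.binomialSeries ℂ c := by
    have key : ∀ n : ℕ, Ring.choose c (n + 1) * ((n : ℂ) + 1) = Ring.choose c n * (c - n) := by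
      intro n
      have := Ring.choose_smul_choose c (Nat.le_succ n)
      simpa [mul_comm] using this
    ext n
    rw [add_mul, one_mul, map_add, PowerSeries.coeff_derivative, PowerSeries.coeff_C_mul]
    have h := key n
    cases n with
    | zero => simp
    | succ n =>
      simp only [PowerSeries.coeff_succ_X_mul, PowerSeries.coeff_derivative,
        PowerSeries.binomialSeries_coeff, smul_eq_mul, mul_one]
      push_cast at h ⊢
      linear_combination h
  linear_combination ((1 - PowerSeries.X) * geomSq) * h -
    PowerSeries.derivative ℂ (PowerSeries.binomialSeries ℂ c) * one_sub_sq_mul_geomSq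

/-- The formal identity
`(1 + X)^e (1 - X²)^(-(e + b)) (1 - X)^(-(c + e)) = (1 - X)^(-(c + 2 e)) (1 - X²)^(-b)`. -/
theorem binomialSeries_mul_negPow (e b c : ℂ) :
    PowerSeries.binomialSeries ℂ e * (PowerSeries.expand 2 two_ne_zero (negPow (e + b)) *
      negPow (c + e)) =
    negPow (c + 2 * e) * PowerSeries.expand 2 two_ne_zero (negPow b) := by
  refine powerSeries_eq_of_logDeriv_eq (L := _) (logDeriv_mul (derivative_binomialSeries e)
    (logDeriv_mul (derivative_expand_negPow _) (derivative_negPow _))) ?_ ?_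
  · rw [logDeriv_mul (derivative_negPow _) (derivative_expand_negPow _)]
    congr 1
    simp only [map_add, map_mul]
    have : PowerSeries.C (2 : ℂ) = 2 := map_ofNat _ 2
    rw [this]
    ring
  · simp [constantCoeff_negPow, PowerSeries.constantCoeff_expand]

/-- The formal power series `exp Z`, for `Z` without constant term. -/
def expSeries (Z : PowerSeries ℂ) : PowerSeries ℂ := (PowerSeries.exp ℂ).subst Z

theorem derivative_expSeries {Z : PowerSeries ℂ} (hZ : PowerSeries.constantCoeff Z = 0) :
    PowerSeries.derivative ℂ (expSeries Z) = PowerSeries.derivative ℂ Z * expSeries Z := by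
  rw [expSeries, PowerSeries.derivative_subst (PowerSeries.HasSubst.of_constantCoeff_zero' hZ),
    PowerSeries.derivative_exp, mul_comm]

theorem coeff_pow_eq_zero {Z : PowerSeries ℂ} (hZ : PowerSeries.constantCoeff Z = 0) {n k : ℕ}
    (h : n < k) : PowerSeries.coeff n (Z ^ k) = 0 :=
  PowerSeries.X_pow_dvd_iff.1 (pow_dvd_pow_of_dvd (PowerSeries.X_dvd_iff.2 hZ) k) n h

theorem coeff_expSeries {Z : PowerSeries ℂ} (hZ : PowerSeries.constantCoeff Z = 0) {n M : ℕ}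
    (hM : n ≤ M) : PowerSeries.coeff n (expSeries Z) =
      PowerSeries.coeff n
        (∑ k ∈ Finset.range (M + 1), PowerSeries.C (1 / (k.factorial : ℂ)) * Z ^ k) := by
  rw [expSeries, PowerSeries.coeff_subst' (PowerSeries.HasSubst.of_constantCoeff_zero' hZ),
    finsum_eq_sum_of_support_subset (s := Finset.range (M + 1)), map_sum]
  · refine Finset.sum_congr rfl fun k _ => ?_
    rw [PowerSeries.coeff_C_mul, PowerSeries.coeff_exp, smul_eq_mul]
    simp
  · intro k hk
    by_contra hk'
    refine hk ?_
    simp only [Finset.coe_range, Set.mem_Iio] at hk'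
    simp only
    rw [coeff_pow_eq_zero hZ (by omega), smul_zero]

theorem coeff_mul_expSeries (F : PowerSeries ℂ) {Z : PowerSeries ℂ}
    (hZ : PowerSeries.constantCoeff Z = 0) {n M : ℕ} (hM : n ≤ M) :
    PowerSeries.coeff n (F * expSeries Z) =
      ∑ k ∈ Finset.range (M + 1),
        1 / (k.factorial : ℂ) * PowerSeries.coeff n (F * Z ^ k) := by
  have h : PowerSeries.coeff n (F * expSeries Z) = PowerSeries.coeff n
      (F * ∑ k ∈ Finset.range (M + 1), PowerSeries.C (1 / (k.factorial : ℂ)) * Z ^ k) := by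
    rw [PowerSeries.coeff_mul, PowerSeries.coeff_mul]
    refine Finset.sum_congr rfl fun p hp => ?_
    rw [coeff_expSeries hZ (M := M) (by
      have := Finset.HasAntidiagonal.mem_antidiagonal.1 hp; omega)]
  rw [h, Finset.mul_sum, map_sum]
  refine Finset.sum_congr rfl fun k _ => ?_
  rw [← PowerSeries.coeff_C_mul]
  congr 1
  ring

theorem constantCoeff_expSeries {Z : PowerSeries ℂ} (hZ : PowerSeries.constantCoeff Z = 0) :
    PowerSeries.constantCoeff (expSeries Z) = 1 := by
  rw [← PowerSeries.coeff_zero_eq_constantCoeff_apply, coeff_expSeries hZ (le_refl 0)]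
  simp

/-- The generating series `∑ L_n^α(x) X^n = (1 - X)^(-α - 1) exp (-x X / (1 - X))` of the Laguerre
polynomials. -/
def laguerreSeries (α x : ℂ) : PowerSeries ℂ :=
  negPow (α + 1) * expSeries (PowerSeries.C (-x) * (PowerSeries.X * negPow 1))

theorem constantCoeff_laguerreExponent (x : ℂ) :
    PowerSeries.constantCoeff (PowerSeries.C (-x) * (PowerSeries.X * negPow 1)) = 0 := by
  simp

theorem negPow_mul_laguerreSeries (c α x : ℂ) :
    negPow c * laguerreSeries α x = laguerreSeries (α + c) x := by
  rw [laguerreSeries, laguerreSeries, ← mul_assoc, negPow_mul]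
  congr 2
  ring

theorem negPow_one_pow (k : ℕ) : negPow 1 ^ k = negPow k := by
  induction k with
  | zero =>
    refine powerSeries_eq_of_logDeriv_eq (L := 0) ?_ ?_ ?_
    · simp
    · rw [derivative_negPow']; simp
    · simp [constantCoeff_negPow]
  | succ k ih => rw [pow_succ, ih, negPow_mul]; push_cast; rfl

theorem coeff_laguerreSeries (α x : ℂ) (n : ℕ) :
    PowerSeries.coeff n (laguerreSeries α x) =
      ∑ p ∈ Finset.range (n + 1),
        (-x) ^ p / (p.factorial : ℂ) * risingCoeff (α + p + 1) (n - p) := by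
  rw [laguerreSeries, coeff_mul_expSeries _ (constantCoeff_laguerreExponent x) (le_refl n)]
  refine Finset.sum_congr rfl fun p hp => ?_
  have : negPow (α + 1) * (PowerSeries.C (-x) * (PowerSeries.X * negPow 1)) ^ p =
      PowerSeries.C ((-x) ^ p) * (PowerSeries.X ^ p * negPow (α + p + 1)) := by
    have h := negPow_mul (α + 1) p
    rw [show α + 1 + p = α + p + 1 by ring] at h
    rw [mul_pow, mul_pow, negPow_one_pow, map_pow, ← h]
    ring
  rw [this, PowerSeries.coeff_C_mul, PowerSeries.coeff_X_pow_mul',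
    if_pos (Nat.lt_succ_iff.1 (Finset.mem_range.1 hp)), coeff_negPow]
  ring

/-! ### The Mehler formula as an identity of formal power series -/

theorem derivative_hermite (n : ℕ) :
    derivative (hermite (n + 1)) = ((n : ℤ[X]) + 1) * hermite n := by
  induction n with
  | zero => simp
  | succ n ih =>
    rw [hermite_succ (n + 1), derivative_sub, derivative_mul, ih, derivative_mul, derivative_X]
    have h := hermite_succ n
    have h1 : derivative ((n : ℤ[X]) + 1) = 0 := by simp
    rw [h1]
    push_cast
    linear_combination -((n : ℤ[X]) + 1) * h

/-- The value at a complex number of the `n`-th probabilists' Hermite polynomial. -/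
def hermiteVal (n : ℕ) (x : ℂ) : ℂ := aeval x (hermite n)

theorem hermiteVal_zero (x : ℂ) : hermiteVal 0 x = 1 := by simp [hermiteVal]

theorem hermiteVal_one (x : ℂ) : hermiteVal 1 x = x := by simp [hermiteVal]

theorem hermiteVal_add_two (n : ℕ) (x : ℂ) :
    hermiteVal (n + 2) x = x * hermiteVal (n + 1) x - ((n : ℂ) + 1) * hermiteVal n x := by
  rw [hermiteVal, hermite_succ (n + 1), derivative_hermite]
  simp [hermiteVal]

/-- The Mehler series `∑ He_n(x) He_n(y) X^n / n!`. -/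
def mehlerSeries (x y : ℂ) : PowerSeries ℂ :=
  PowerSeries.mk fun n => hermiteVal n x * hermiteVal n y / (n.factorial : ℂ)

/-- The companion `∑ He_n(x) He_{n+1}(y) X^n / n!` of the Mehler series. -/
def mehlerShift (x y : ℂ) : PowerSeries ℂ :=
  PowerSeries.mk fun n => hermiteVal n x * hermiteVal (n + 1) y / (n.factorial : ℂ)

theorem mehlerShift_eq (x y : ℂ) :
    mehlerShift x y = PowerSeries.C y * mehlerSeries x y - PowerSeries.X * mehlerShift y x := by
  ext n
  rw [map_sub, PowerSeries.coeff_C_mul]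
  cases n with
  | zero => simp [mehlerShift, mehlerSeries, hermiteVal_zero, hermiteVal_one]
  | succ n =>
    rw [PowerSeries.coeff_succ_X_mul, mehlerShift, mehlerShift, mehlerSeries, PowerSeries.coeff_mk,
      PowerSeries.coeff_mk, PowerSeries.coeff_mk, hermiteVal_add_two, Nat.factorial_succ]
    have h1 : ((n : ℂ) + 1) ≠ 0 := Nat.cast_add_one_ne_zero n
    have h2 : (n.factorial : ℂ) ≠ 0 := Nat.cast_ne_zero.2 n.factorial_ne_zero
    push_cast
    field_simp

theorem derivative_mehlerSeries_eq (x y : ℂ) :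
    PowerSeries.derivative ℂ (mehlerSeries x y) =
      PowerSeries.C x * mehlerShift x y - PowerSeries.X * (PowerSeries.C y * mehlerShift x y -
        (mehlerSeries x y + PowerSeries.X * PowerSeries.derivative ℂ (mehlerSeries x y))) := by
  ext n
  rw [map_sub, PowerSeries.coeff_C_mul, PowerSeries.coeff_derivative]
  have h1 : ∀ n : ℕ, ((n : ℂ) + 1) ≠ 0 := Nat.cast_add_one_ne_zero
  have h2 : (n.factorial : ℂ) ≠ 0 := Nat.cast_ne_zero.2 n.factorial_ne_zero
  cases n with
  | zero => simp [mehlerShift, mehlerSeries, hermiteVal_zero, hermiteVal_one]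
  | succ n =>
    have h3 : PowerSeries.coeff n (mehlerSeries x y +
        PowerSeries.X * PowerSeries.derivative ℂ (mehlerSeries x y)) =
        ((n : ℂ) + 1) * PowerSeries.coeff n (mehlerSeries x y) := by
      cases n with
      | zero => simp
      | succ n =>
        rw [map_add, PowerSeries.coeff_succ_X_mul, PowerSeries.coeff_derivative]
        push_cast
        ring
    rw [PowerSeries.coeff_succ_X_mul, map_sub, h3, PowerSeries.coeff_C_mul]
    simp only [mehlerShift, mehlerSeries, PowerSeries.coeff_mk]
    rw [hermiteVal_add_two n x, hermiteVal_add_two n y, Nat.factorial_succ (n + 1),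
      Nat.factorial_succ n]
    have h4 : (n.factorial : ℂ) ≠ 0 := Nat.cast_ne_zero.2 n.factorial_ne_zero
    have h5 := h1 n
    have h6 := h1 (n + 1)
    push_cast at h6 ⊢
    field_simp

/-- The differential equation of the Mehler series; the three-term recurrence in `x` and in `y`
gives two linear relations between the series and its companions, which are solved for the latter. -/
theorem derivative_mehlerSeries (x y : ℂ) :
    PowerSeries.derivative ℂ (mehlerSeries x y) =
      ((PowerSeries.C (x * y) * (1 + PowerSeries.X ^ 2) -
          PowerSeries.C (x ^ 2 + y ^ 2) * PowerSeries.X) * geomSq ^ 2 +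
        PowerSeries.X * geomSq) * mehlerSeries x y := by
  have h1 := mehlerShift_eq x y
  have h2 := mehlerShift_eq y x
  have h2' : mehlerSeries y x = mehlerSeries x y := by
    ext n; simp [mehlerSeries, mul_comm]
  rw [h2'] at h2
  have h3 := derivative_mehlerSeries_eq x y
  have hg := one_sub_sq_mul_geomSq
  have h4 : mehlerShift x y = geomSq *
      ((PowerSeries.C y - PowerSeries.C x * PowerSeries.X) * mehlerSeries x y) := by
    linear_combination geomSq * h1 - geomSq * PowerSeries.X * h2 - mehlerShift x y * hg
  simp only [map_mul, map_add, map_pow]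
  linear_combination geomSq * h3 + geomSq * (PowerSeries.C x - PowerSeries.C y * PowerSeries.X) * h4
    - PowerSeries.derivative ℂ (mehlerSeries x y) * hg

theorem constantCoeff_mehlerSeries (x y : ℂ) :
    PowerSeries.constantCoeff (mehlerSeries x y) = 1 := by
  rw [← PowerSeries.coeff_zero_eq_constantCoeff_apply, mehlerSeries, PowerSeries.coeff_mk]
  simp [hermiteVal_zero]

theorem constantCoeff_laguerreSeries (α x : ℂ) :
    PowerSeries.constantCoeff (laguerreSeries α x) = 1 := by
  rw [laguerreSeries, map_mul, constantCoeff_negPow,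
    constantCoeff_expSeries (constantCoeff_laguerreExponent x), one_mul]

theorem derivative_laguerreSeries (α x : ℂ) :
    PowerSeries.derivative ℂ (laguerreSeries α x) =
      (PowerSeries.C (α + 1) * negPow 1 - PowerSeries.C x * negPow 1 ^ 2) *
        laguerreSeries α x := by
  rw [laguerreSeries, logDeriv_mul (derivative_negPow' (α + 1))
    (derivative_expSeries (constantCoeff_laguerreExponent x))]
  congr 1
  rw [Derivation.leibniz, Derivation.leibniz, PowerSeries.derivative_C, PowerSeries.derivative_X,
    derivative_negPow']
  simp only [smul_eq_mul, map_one, map_neg]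
  linear_combination PowerSeries.C x * negPow 1 * one_sub_mul_negPow_one

theorem derivative_expand_laguerreSeries (α x : ℂ) :
    PowerSeries.derivative ℂ (PowerSeries.expand 2 two_ne_zero (laguerreSeries α x)) =
      2 * PowerSeries.X * (PowerSeries.C (α + 1) * geomSq - PowerSeries.C x * geomSq ^ 2) *
        PowerSeries.expand 2 two_ne_zero (laguerreSeries α x) := by
  rw [derivative_expand_two, derivative_laguerreSeries, map_mul, map_sub, map_mul, map_mul,
    PowerSeries.expand_C, PowerSeries.expand_C, map_pow, ← geomSq]
  ring

/-- Mehler's formula in `D` variables: the logarithmic derivatives of the two sides agree. -/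
theorem prod_mehlerSeries (D : ℕ) (x y : Fin D → ℂ) :
    ∏ i, mehlerSeries (x i) (y i) =
      PowerSeries.expand 2 two_ne_zero
          (laguerreSeries ((D : ℂ) / 2 - 1) ((∑ i, (x i ^ 2 + y i ^ 2)) / 2)) *
        expSeries (PowerSeries.C (∑ i, x i * y i) * (PowerSeries.X * geomSq)) := by
  have h0 : PowerSeries.constantCoeff
      (PowerSeries.C (∑ i, x i * y i) * (PowerSeries.X * geomSq)) = 0 := by simp
  refine powerSeries_eq_of_logDeriv_eq (L := _)
    (logDeriv_prod Finset.univ fun i _ => derivative_mehlerSeries (x i) (y i)) ?_ ?_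
  · rw [logDeriv_mul (derivative_expand_laguerreSeries _ _) (derivative_expSeries h0)]
    congr 1
    have hs : (∑ i, ((PowerSeries.C (x i * y i) * (1 + PowerSeries.X ^ 2) -
        PowerSeries.C (x i ^ 2 + y i ^ 2) * PowerSeries.X) * geomSq ^ 2 +
          PowerSeries.X * geomSq)) =
        (PowerSeries.C (∑ i, x i * y i) * (1 + PowerSeries.X ^ 2) -
          PowerSeries.C (∑ i, (x i ^ 2 + y i ^ 2)) * PowerSeries.X) * geomSq ^ 2 +
          (D : PowerSeries ℂ) * (PowerSeries.X * geomSq) := by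
      rw [map_sum, map_sum, Finset.sum_mul, Finset.sum_mul, ← Finset.sum_sub_distrib,
        Finset.sum_mul, Finset.sum_add_distrib]
      simp
    rw [hs, Derivation.leibniz, Derivation.leibniz, PowerSeries.derivative_C,
      PowerSeries.derivative_X, derivative_geomSq]
    simp only [smul_eq_mul, sub_add_cancel]
    have h1 : 2 * PowerSeries.C ((D : ℂ) / 2) = (D : PowerSeries ℂ) := by
      have : (2 : PowerSeries ℂ) = PowerSeries.C 2 := (map_ofNat _ 2).symm
      rw [this, ← map_mul, mul_div_cancel₀ _ two_ne_zero, map_natCast]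
    have h2 : 2 * PowerSeries.C ((∑ i, (x i ^ 2 + y i ^ 2)) / 2) =
        PowerSeries.C (∑ i, (x i ^ 2 + y i ^ 2)) := by
      have : (2 : PowerSeries ℂ) = PowerSeries.C 2 := (map_ofNat _ 2).symm
      rw [this, ← map_mul, mul_div_cancel₀ _ two_ne_zero]
    linear_combination PowerSeries.X * geomSq * h1 - PowerSeries.X * geomSq ^ 2 * h2
      - PowerSeries.C (∑ i, x i * y i) * geomSq * one_sub_sq_mul_geomSq
  · rw [map_prod, map_mul, constantCoeff_expSeries h0, PowerSeries.constantCoeff_expand,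
      constantCoeff_laguerreSeries]
    simp [constantCoeff_mehlerSeries]

/-- Each factor `X / (1 - X²)` of the exponential series raises the type of the Laguerre series
by one. -/
theorem coeff_expand_mul_expSeries (α S Y : ℂ) {n M : ℕ} (hM : n ≤ M) :
    PowerSeries.coeff n (PowerSeries.expand 2 two_ne_zero (laguerreSeries α S) *
        expSeries (PowerSeries.C Y * (PowerSeries.X * geomSq))) =
      ∑ k ∈ Finset.range (M + 1), Y ^ k / (k.factorial : ℂ) *
        PowerSeries.coeff n (PowerSeries.X ^ k *
          PowerSeries.expand 2 two_ne_zero (laguerreSeries (α + k) S)) := by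
  rw [coeff_mul_expSeries _ (by simp) hM]
  refine Finset.sum_congr rfl fun k _ => ?_
  have : PowerSeries.expand 2 two_ne_zero (laguerreSeries α S) *
      (PowerSeries.C Y * (PowerSeries.X * geomSq)) ^ k = PowerSeries.C (Y ^ k) *
      (PowerSeries.X ^ k * PowerSeries.expand 2 two_ne_zero (laguerreSeries (α + k) S)) := by
    rw [← negPow_mul_laguerreSeries, ← negPow_one_pow, map_mul, map_pow, map_pow, ← geomSq]
    ring
  rw [this, PowerSeries.coeff_C_mul]
  ring

theorem hermiteFun_mul (n : ℕ) (a b : ℝ) :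
    ((hermiteFun n a * hermiteFun n b : ℝ) : ℂ) =
      ((Real.exp (-(a ^ 2 + b ^ 2) / 2) / √Real.pi : ℝ) : ℂ) *
        PowerSeries.coeff n (mehlerSeries ((√2 * a : ℝ) : ℂ) ((√2 * b : ℝ) : ℂ)) := by
  have hv : ∀ x : ℝ, hermiteVal n (x : ℂ) = ((aeval x (hermite n) : ℝ) : ℂ) := fun x =>
    Polynomial.aeval_algebraMap_apply ℂ x (hermite n)
  rw [mehlerSeries, PowerSeries.coeff_mk, hv, hv]
  have h1 : (0 : ℝ) ≤ (n.factorial : ℝ) * √Real.pi := by positivity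
  have h2 : √((n.factorial : ℝ) * √Real.pi) ^ 2 = (n.factorial : ℝ) * √Real.pi := Real.sq_sqrt h1
  have h3 : (0 : ℝ) < √((n.factorial : ℝ) * √Real.pi) := by positivity
  have h4 : (0 : ℝ) < √Real.pi := by positivity
  have h5 : (0 : ℝ) < n.factorial := by positivity
  have h6 : Real.exp (-(a ^ 2 + b ^ 2) / 2) = Real.exp (-a ^ 2 / 2) * Real.exp (-b ^ 2 / 2) := by
    rw [← Real.exp_add]; congr 1; ring
  norm_cast
  rw [hermiteFun, hermiteFun, h6, div_mul_div_comm, ← pow_two √((n.factorial : ℝ) * √Real.pi), h2]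
  field_simp

/-- The sum over multi-indices of a given length is a coefficient of a product of series. -/
theorem hermiteProjKernel_eq_coeff (D n : ℕ) (x y : EuclideanSpace ℝ (Fin D)) :
    (hermiteProjKernel D n x y : ℂ) =
      ((Real.exp (-(‖x‖ ^ 2 + ‖y‖ ^ 2) / 2) / √Real.pi ^ D : ℝ) : ℂ) *
        PowerSeries.coeff n (∏ i, mehlerSeries ((√2 * x i : ℝ) : ℂ) ((√2 * y i : ℝ) : ℂ)) := by
  rw [hermiteProjKernel, PowerSeries.coeff_prod, Finset.finsuppAntidiag, Finset.sum_map,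
    ← Finset.sum_attach (Finset.piAntidiag Finset.univ n), Finset.mul_sum, Complex.ofReal_sum]
  refine Finset.sum_congr rfl fun μ _ => ?_
  have h1 : Real.exp (-(‖x‖ ^ 2 + ‖y‖ ^ 2) / 2) / √Real.pi ^ D =
      ∏ i : Fin D, Real.exp (-(x i ^ 2 + y i ^ 2) / 2) / √Real.pi := by
    rw [Finset.prod_div_distrib, ← Real.exp_sum, Finset.prod_const, Finset.card_univ,
      Fintype.card_fin, EuclideanSpace.norm_sq_eq, EuclideanSpace.norm_sq_eq, ← Finset.sum_div,
      Finset.sum_neg_distrib, Finset.sum_add_distrib]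
    simp
  rw [h1, hermiteFunction, hermiteFunction, ← Finset.prod_mul_distrib, Complex.ofReal_prod,
    Complex.ofReal_prod, ← Finset.prod_mul_distrib]
  exact Finset.prod_congr rfl fun i _ => hermiteFun_mul _ _ _

/-- The Mehler formula in polynomial form: the kernels of the Hermite projections on `ℝ^D` expand
in powers of the inner product, with Laguerre polynomials of `‖x‖² + ‖y‖²` as coefficients. -/
theorem hermiteProjKernel_eq_sum (D : ℕ) (x y : EuclideanSpace ℝ (Fin D)) {n M : ℕ} (hM : n ≤ M) :
    (hermiteProjKernel D n x y : ℂ) =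
      ((Real.exp (-(‖x‖ ^ 2 + ‖y‖ ^ 2) / 2) / √Real.pi ^ D : ℝ) : ℂ) *
        ∑ k ∈ Finset.range (M + 1), ((2 * inner ℝ x y : ℝ) : ℂ) ^ k / (k.factorial : ℂ) *
          PowerSeries.coeff n (PowerSeries.X ^ k * PowerSeries.expand 2 two_ne_zero
            (laguerreSeries ((D : ℂ) / 2 - 1 + k) ((‖x‖ ^ 2 + ‖y‖ ^ 2 : ℝ) : ℂ))) := by
  have h2 : ((√2 : ℝ) : ℂ) ^ 2 = 2 := by
    rw [← Complex.ofReal_pow, Real.sq_sqrt (by norm_num)]; simp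
  have e1 : (∑ i, (((√2 * x i : ℝ) : ℂ) ^ 2 + ((√2 * y i : ℝ) : ℂ) ^ 2)) / 2 =
      ((‖x‖ ^ 2 + ‖y‖ ^ 2 : ℝ) : ℂ) := by
    rw [EuclideanSpace.norm_sq_eq, EuclideanSpace.norm_sq_eq, ← Finset.sum_add_distrib,
      Complex.ofReal_sum, Finset.sum_div]
    refine Finset.sum_congr rfl fun i _ => ?_
    simp only [Real.norm_eq_abs, sq_abs]
    push_cast
    linear_combination ((x i : ℂ) ^ 2 + (y i : ℂ) ^ 2) / 2 * h2
  have e2 : ∑ i, ((√2 * x i : ℝ) : ℂ) * ((√2 * y i : ℝ) : ℂ) = ((2 * inner ℝ x y : ℝ) : ℂ) := by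
    rw [PiLp.inner_apply, Finset.mul_sum, Complex.ofReal_sum]
    refine Finset.sum_congr rfl fun i _ => ?_
    simp only [RCLike.inner_apply, conj_trivial]
    push_cast
    linear_combination ((x i : ℂ) * (y i : ℂ)) * h2
  rw [hermiteProjKernel_eq_coeff, prod_mehlerSeries, e1, e2, coeff_expand_mul_expSeries _ _ _ hM]

/-- The Hermite Cesàro kernel of `D ≥ 2` variables is a function of the two norms and of the inner
product. -/
theorem hermiteCesaroKernel_congr (D : ℕ) (δ : ℂ) (n : ℕ) {x y x' y' : EuclideanSpace ℝ (Fin D)}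
    (hx : ‖x‖ = ‖x'‖) (hy : ‖y‖ = ‖y'‖) (hxy : inner ℝ x y = inner ℝ x' y') :
    hermiteCesaroKernel D δ n x y = hermiteCesaroKernel D δ n x' y' := by
  rw [hermiteCesaroKernel, hermiteCesaroKernel]
  congr 1
  refine Finset.sum_congr rfl fun j _ => ?_
  rw [hermiteProjKernel_eq_sum D x y (le_refl j), hermiteProjKernel_eq_sum D x' y' (le_refl j),
    hx, hy, hxy]

/-- The unit vector `(1, 0, …, 0)`. -/
def poleVec (D : ℕ) : EuclideanSpace ℝ (Fin D) :=
  WithLp.toLp 2 (fun i : Fin D => if (i : ℕ) = 0 then 1 else 0)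

/-- The unit vector `(u, √(1 - u²), 0, …, 0)`. -/
def tiltVec (D : ℕ) (u : ℝ) : EuclideanSpace ℝ (Fin D) :=
  WithLp.toLp 2
    (fun i : Fin D => if (i : ℕ) = 0 then u else if (i : ℕ) = 1 then √(1 - u ^ 2) else 0)

theorem norm_poleVec {D : ℕ} (hD : 2 ≤ D) : ‖poleVec D‖ = 1 := by
  obtain ⟨k, rfl⟩ := Nat.exists_eq_add_of_le' hD
  rw [EuclideanSpace.norm_eq, Fin.sum_univ_succ]
  simp [poleVec]

theorem norm_tiltVec {D : ℕ} (hD : 2 ≤ D) {u : ℝ} (hu : u ∈ Set.Icc (-1 : ℝ) 1) :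
    ‖tiltVec D u‖ = 1 := by
  obtain ⟨k, rfl⟩ := Nat.exists_eq_add_of_le' hD
  have h : 0 ≤ 1 - u ^ 2 := by nlinarith [hu.1, hu.2]
  rw [EuclideanSpace.norm_eq, Fin.sum_univ_succ, Fin.sum_univ_succ]
  simp [tiltVec, Real.sq_sqrt h]

theorem inner_poleVec_tiltVec {D : ℕ} (hD : 2 ≤ D) (u : ℝ) :
    inner ℝ (poleVec D) (tiltVec D u) = u := by
  obtain ⟨k, rfl⟩ := Nat.exists_eq_add_of_le' hD
  rw [PiLp.inner_apply, Fin.sum_univ_succ]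
  simp [tiltVec, poleVec]

theorem hermiteCesaroKernel_eq_radial {D : ℕ} (hD : 2 ≤ D) (δ : ℂ) (n : ℕ) (r s : ℝ)
    {x' y' : EuclideanSpace ℝ (Fin D)} (hx : ‖x'‖ = 1) (hy : ‖y'‖ = 1) :
    hermiteCesaroKernel D δ n (r • x') (s • y') =
      radialCesaroKernel D δ n r s (inner ℝ x' y') := by
  have hu : inner ℝ x' y' ∈ Set.Icc (-1 : ℝ) 1 := by
    have := abs_real_inner_le_norm x' y'
    rw [hx, hy, mul_one] at this
    exact abs_le.1 this
  refine hermiteCesaroKernel_congr D δ n (x' := r • poleVec D)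
    (y' := s • tiltVec D (inner ℝ x' y')) ?_ ?_ ?_
  · rw [norm_smul, norm_smul, hx, norm_poleVec hD]
  · rw [norm_smul, norm_smul, hy, norm_tiltVec hD hu]
  · rw [real_inner_smul_left, real_inner_smul_right, real_inner_smul_left, real_inner_smul_right,
      inner_poleVec_tiltVec hD]

/-- The coefficients of the expansion of the Hermite projection kernels in powers of `2 r s u`, for
`x` and `y` of norms `r` and `s`. -/
def projCoeff (D n k : ℕ) (r s : ℝ) : ℂ :=
  ((Real.exp (-(r ^ 2 + s ^ 2) / 2) / √Real.pi ^ D : ℝ) : ℂ) *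
    ((2 * (r * s) : ℂ) ^ k / (k.factorial : ℂ) *
      PowerSeries.coeff n (PowerSeries.X ^ k * PowerSeries.expand 2 two_ne_zero
        (laguerreSeries ((D : ℂ) / 2 - 1 + k) ((r ^ 2 + s ^ 2 : ℝ) : ℂ))))

theorem radialCesaroKernel_eq {D : ℕ} (hD : 2 ≤ D) (δ : ℂ) (n : ℕ) (r s : ℝ) {u : ℝ}
    (hu : u ∈ Set.Icc (-1 : ℝ) 1) :
    radialCesaroKernel D δ n r s u = 1 / cesaroNumber δ n *
      ∑ i ∈ Finset.range (n + 1), cesaroNumber δ (n - i) *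
        ∑ k ∈ Finset.range (n + 1), projCoeff D i k r s * (u : ℂ) ^ k := by
  change hermiteCesaroKernel D δ n (r • poleVec D) (s • tiltVec D u) = _
  rw [hermiteCesaroKernel]
  congr 1
  refine Finset.sum_congr rfl fun i hi => ?_
  rw [hermiteProjKernel_eq_sum D _ _ (Nat.lt_succ_iff.1 (Finset.mem_range.1 hi)),
    norm_smul, norm_smul, norm_poleVec hD, norm_tiltVec hD hu, real_inner_smul_left,
    real_inner_smul_right, inner_poleVec_tiltVec hD, Finset.mul_sum]
  congr 1
  refine Finset.sum_congr rfl fun k _ => ?_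
  rw [projCoeff]
  simp only [mul_one, Real.norm_eq_abs, sq_abs]
  push_cast
  ring

/-! ### Laguerre polynomials and their product formula -/

/-- The Laguerre polynomial `L_n^α` as a formal polynomial. -/
def lagPoly (α : ℂ) (n : ℕ) : ℂ[X] :=
  ∑ p ∈ Finset.range (n + 1),
    monomial p ((-1) ^ p / (p.factorial : ℂ) * risingCoeff (α + p + 1) (n - p))

theorem coeff_lagPoly (α : ℂ) (n p : ℕ) :
    (lagPoly α n).coeff p =
      if p ≤ n then (-1) ^ p / (p.factorial : ℂ) * risingCoeff (α + p + 1) (n - p) else 0 := by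
  rw [lagPoly, finsetSum_coeff]
  simp only [coeff_monomial]
  rw [Finset.sum_ite_eq' (Finset.range (n + 1)) p]
  simp

theorem eval_lagPoly (α x : ℂ) (n : ℕ) :
    (lagPoly α n).eval x = PowerSeries.coeff n (laguerreSeries α x) := by
  rw [coeff_laguerreSeries, lagPoly, eval_finsetSum]
  refine Finset.sum_congr rfl fun p _ => ?_
  rw [eval_monomial, neg_pow]
  ring

theorem lagPoly_zero (α : ℂ) : lagPoly α 0 = 1 := by
  simp [lagPoly, risingCoeff_zero]

theorem derivative_lagPoly (α : ℂ) (n : ℕ) :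
    derivative (lagPoly α (n + 1)) = -lagPoly (α + 1) n := by
  ext p
  rw [coeff_derivative, coeff_neg, coeff_lagPoly, coeff_lagPoly]
  have h1 : ((p : ℂ) + 1) ≠ 0 := Nat.cast_add_one_ne_zero p
  have h2 : (p.factorial : ℂ) ≠ 0 := Nat.cast_ne_zero.2 p.factorial_ne_zero
  by_cases h : p ≤ n
  · rw [if_pos h, if_pos (by omega), Nat.factorial_succ, Nat.add_sub_add_right,
      show α + ((p + 1 : ℕ) : ℂ) + 1 = α + 1 + p + 1 by push_cast; ring]
    push_cast
    field_simp
    ring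
  · rw [if_neg h, if_neg (by omega)]
    simp

theorem lagPoly_succ_add (α : ℂ) (n : ℕ) :
    lagPoly (α + 1) (n + 1) = lagPoly α (n + 1) + lagPoly (α + 1) n := by
  refine Polynomial.funext fun x => ?_
  rw [eval_add, eval_lagPoly, eval_lagPoly, eval_lagPoly]
  have h : laguerreSeries α x = (1 - PowerSeries.X) * laguerreSeries (α + 1) x := by
    rw [← negPow_mul_laguerreSeries, ← mul_assoc, one_sub_mul_negPow_one, one_mul]
  rw [h, sub_mul, one_mul, map_sub, PowerSeries.coeff_succ_X_mul]
  ring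

/-- The Laguerre equation, read off coefficientwise. -/
theorem coeff_succ_lagPoly (α : ℂ) (n p : ℕ) :
    ((p : ℂ) + 1) * (p + α + 1) * (lagPoly α n).coeff (p + 1) =
      (p - n) * (lagPoly α n).coeff p := by
  rw [coeff_lagPoly, coeff_lagPoly]
  have h1 : ((p : ℂ) + 1) ≠ 0 := Nat.cast_add_one_ne_zero p
  have h2 : (p.factorial : ℂ) ≠ 0 := Nat.cast_ne_zero.2 p.factorial_ne_zero
  rcases lt_trichotomy p n with h | h | h
  · obtain ⟨k, rfl⟩ := Nat.exists_eq_add_of_lt h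
    rw [if_pos (by omega), if_pos (by omega), show p + k + 1 - (p + 1) = k by omega,
      show p + k + 1 - p = k + 1 by omega, Nat.factorial_succ]
    have key : (α + p + 1) * risingCoeff (α + ((p + 1 : ℕ) : ℂ) + 1) k =
        ((k : ℂ) + 1) * risingCoeff (α + p + 1) (k + 1) := by
      have hk : ((k : ℂ) + 1) ≠ 0 := Nat.cast_add_one_ne_zero k
      have hk' : (k.factorial : ℂ) ≠ 0 := Nat.cast_ne_zero.2 k.factorial_ne_zero
      rw [risingCoeff, risingCoeff, ascPochhammer_succ_left, eval_mul, eval_comp,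
        Nat.factorial_succ, show α + ((p + 1 : ℕ) : ℂ) + 1 = α + p + 1 + 1 by push_cast; ring]
      simp only [eval_X, eval_add, eval_one]
      push_cast
      field_simp
    push_cast at key ⊢
    field_simp
    linear_combination (-1) ^ (p + 1) * key
  · subst h
    simp
  · rw [if_neg (by omega), if_neg (by omega)]
    simp

/-- The operator `P ↦ X (X P'' + (α + 1 - X) P' + n P)`: the Laguerre equation, multiplied by
`X`. -/
def laguerreOp (α : ℂ) (n : ℕ) (P : ℂ[X]) : ℂ[X] :=
  X ^ 2 * derivative (derivative P) + (C (α + 1) - X) * (X * derivative P) + C (n : ℂ) * (X * P)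

theorem coeff_laguerreOp (α : ℂ) (n p : ℕ) (P : ℂ[X]) :
    (laguerreOp α n P).coeff (p + 1) =
      ((p : ℂ) + 1) * (p + α + 1) * P.coeff (p + 1) - (p - n) * P.coeff p := by
  rw [laguerreOp, coeff_add, coeff_add, sub_mul, coeff_sub, coeff_C_mul, coeff_C_mul,
    coeff_X_mul, coeff_X_mul, coeff_X_mul, coeff_derivative, pow_two, mul_assoc, coeff_X_mul]
  cases p with
  | zero => simp
  | succ p =>
    rw [coeff_X_mul, coeff_X_mul, coeff_derivative, coeff_derivative, coeff_derivative]
    push_cast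
    ring

theorem laguerreOp_lagPoly (α : ℂ) (n : ℕ) : laguerreOp α n (lagPoly α n) = 0 := by
  ext p
  cases p with
  | zero => simp [laguerreOp, coeff_zero_eq_eval_zero]
  | succ p => rw [coeff_laguerreOp, coeff_succ_lagPoly, sub_self, coeff_zero]

theorem laguerre_ode (α : ℂ) (n : ℕ) :
    X * derivative (derivative (lagPoly α n)) + (C (α + 1) - X) * derivative (lagPoly α n) +
      C (n : ℂ) * lagPoly α n = 0 := by
  have h := laguerreOp_lagPoly α n
  refine (mul_eq_zero.1 (?_ : X * _ = 0)).resolve_left X_ne_zero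
  rw [← h, laguerreOp]
  ring

/-- A polynomial solution of the Laguerre equation is determined by its value at the origin. -/
theorem eq_smul_lagPoly_of_laguerreOp_eq_zero {α : ℂ} (hα : ∀ p : ℕ, (p : ℂ) + α + 1 ≠ 0) {n : ℕ}
    {P : ℂ[X]} (hP : laguerreOp α n P = 0) {c : ℂ}
    (h0 : P.coeff 0 = c * (lagPoly α n).coeff 0) : P = C c * lagPoly α n := by
  ext p
  rw [coeff_C_mul]
  induction p with
  | zero => exact h0
  | succ p ih =>
    have h := coeff_laguerreOp α n p P
    rw [hP, coeff_zero, ih] at h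
    have h' := coeff_succ_lagPoly α n p
    have hp : ((p : ℂ) + 1) * (p + α + 1) ≠ 0 := mul_ne_zero (Nat.cast_add_one_ne_zero p) (hα p)
    exact mul_left_cancel₀ hp (by linear_combination -h - c * h')

/-- The contiguity relation `L'' - L' = L_n^{α + 2}` for `L = L_{n + 1}^α`, which makes the product
formula telescope. -/
theorem derivative_derivative_lagPoly_sub (α : ℂ) (n : ℕ) :
    derivative (derivative (lagPoly α (n + 1))) - derivative (lagPoly α (n + 1)) =
      lagPoly (α + 2) n := by
  rw [derivative_lagPoly, derivative_neg]
  cases n with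
  | zero => simp [lagPoly_zero]
  | succ n =>
    rw [derivative_lagPoly, show α + 2 = α + 1 + 1 by ring, lagPoly_succ_add (α + 1) n]
    ring

/-- The polynomial `L_{n - l}^{α + 2 l}(X + y)`, and `0` for `l > n`. -/
def shiftedLag (α : ℂ) (n : ℕ) (y : ℂ) (l : ℕ) : ℂ[X] :=
  if l ≤ n then (lagPoly (α + 2 * l) (n - l)).comp (X + C y) else 0

theorem derivative_comp_X_add_C (P : ℂ[X]) (y : ℂ) :
    derivative (P.comp (X + C y)) = (derivative P).comp (X + C y) := by
  rw [derivative_comp]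
  simp

theorem derivative_derivative_shiftedLag_sub (α : ℂ) (n : ℕ) (y : ℂ) {l : ℕ} (hl : l ≤ n) :
    derivative (derivative (shiftedLag α n y l)) - derivative (shiftedLag α n y l) =
      shiftedLag α n y (l + 1) := by
  rw [shiftedLag, if_pos hl, derivative_comp_X_add_C, derivative_comp_X_add_C, ← sub_comp]
  rcases hl.eq_or_lt with h | h
  · subst h
    simp [shiftedLag, lagPoly_zero]
  · obtain ⟨k, rfl⟩ := Nat.exists_eq_add_of_lt h
    rw [show l + k + 1 - l = k + 1 by omega, derivative_derivative_lagPoly_sub, shiftedLag,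
      if_pos (by omega), show l + k + 1 - (l + 1) = k by omega]
    congr 2
    push_cast
    ring

theorem shiftedLag_ode (α : ℂ) (n : ℕ) (y : ℂ) {l : ℕ} (hl : l ≤ n) :
    (X + C y) * derivative (derivative (shiftedLag α n y l)) +
      (C (α + 2 * l + 1) - (X + C y)) * derivative (shiftedLag α n y l) +
      (C (n : ℂ) - C (l : ℂ)) * shiftedLag α n y l = 0 := by
  have h := congrArg (fun P : ℂ[X] => P.comp (X + C y)) (laguerre_ode (α + 2 * l) (n - l))
  simp only [add_comp, mul_comp, sub_comp, X_comp, C_comp, zero_comp] at h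
  rw [shiftedLag, if_pos hl, derivative_comp_X_add_C, derivative_comp_X_add_C, ← C_sub,
    ← Nat.cast_sub hl]
  exact h

theorem X_mul_derivative_X_pow (l : ℕ) : X * derivative (X ^ l : ℂ[X]) = C (l : ℂ) * X ^ l := by
  cases l with
  | zero => simp
  | succ l => rw [derivative_X_pow, Nat.add_sub_cancel]; push_cast; ring

theorem X_sq_mul_derivative_X_pow (l : ℕ) :
    X ^ 2 * derivative (derivative (X ^ l : ℂ[X])) = C (l : ℂ) * (C (l : ℂ) - 1) * X ^ l := by
  have h := congrArg derivative (X_mul_derivative_X_pow l)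
  rw [derivative_mul, derivative_X, one_mul, derivative_C_mul] at h
  linear_combination X * h + (C (l : ℂ) - 1) * X_mul_derivative_X_pow l

/-- The Laguerre operator maps the `l`-th term of the product formula to a difference of
consecutive terms of one sequence. -/
theorem laguerreOp_term (α : ℂ) (n : ℕ) (y c : ℂ) {l : ℕ} (hl : l ≤ n) :
    laguerreOp α n (C c * (X ^ l * shiftedLag α n y l)) =
      C (c * (l * (l + α))) * (X ^ l * shiftedLag α n y l) -
        C (c * y) * (X ^ (l + 1) * shiftedLag α n y (l + 1)) := by
  have h1 := X_mul_derivative_X_pow l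
  have h2 := X_sq_mul_derivative_X_pow l
  have h3 := shiftedLag_ode α n y hl
  have h4 := derivative_derivative_shiftedLag_sub α n y hl
  rw [laguerreOp, derivative_C_mul, derivative_C_mul, derivative_mul, derivative_add,
    derivative_mul, derivative_mul, ← h4]
  simp only [map_mul, map_add, map_one, map_ofNat] at h3 ⊢
  set Q := shiftedLag α n y l
  linear_combination C c * Q * h2 +
    C c * (2 * X * derivative Q + (C α + 1 - X) * Q) * h1 + C c * X ^ (l + 1) * h3

/-- The product formula for Laguerre polynomials:
`c_n L_n^α(x) L_n^α(y) = ∑_l g_l (x y)^l L_{n - l}^{α + 2 l}(x + y)`, where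
`g_l = 1 / (l! Γ(l + α + 1))` and `c_n = n! / Γ(n + α + 1)`. -/
theorem laguerre_product {α : ℂ} (hα : -1 < α.re) (n : ℕ) (x y : ℂ) :
    (n.factorial : ℂ) / Complex.Gamma (n + α + 1) *
        ((lagPoly α n).eval x * (lagPoly α n).eval y) =
      ∑ l ∈ Finset.range (n + 1),
        (x * y) ^ l / ((l.factorial : ℂ) * Complex.Gamma (l + α + 1)) *
          (lagPoly (α + 2 * l) (n - l)).eval (x + y) := by
  have hre : ∀ p : ℕ, 0 < ((p : ℂ) + α + 1).re := by
    intro p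
    have : (0 : ℝ) ≤ p := p.cast_nonneg
    simp only [Complex.add_re, Complex.natCast_re, Complex.one_re]
    linarith
  have hne : ∀ p : ℕ, (p : ℂ) + α + 1 ≠ 0 := fun p h => by
    have := hre p
    rw [h] at this
    simp at this
  have hG : ∀ p : ℕ, Complex.Gamma ((p : ℂ) + α + 1) ≠ 0 := fun p =>
    Complex.Gamma_ne_zero_of_re_pos (hre p)
  have hGs : ∀ p : ℕ, Complex.Gamma (((p + 1 : ℕ) : ℂ) + α + 1) =
      (p + α + 1) * Complex.Gamma (p + α + 1) := fun p => by
    rw [← Complex.Gamma_add_one _ (hne p)]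
    congr 1
    push_cast
    ring
  have hfac : ∀ p : ℕ, (p.factorial : ℂ) ≠ 0 := fun p => Nat.cast_ne_zero.2 p.factorial_ne_zero
  set g : ℕ → ℂ := fun l => y ^ l / ((l.factorial : ℂ) * Complex.Gamma (l + α + 1)) with hg
  have hgs : ∀ l : ℕ, g (l + 1) * (((l + 1 : ℕ) : ℂ) * (((l + 1 : ℕ) : ℂ) + α)) = g l * y := by
    intro l
    have h1 : ((l : ℂ) + 1) ≠ 0 := Nat.cast_add_one_ne_zero l
    have h2 := hne l
    have h3 := hG l
    have h4 := hfac l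
    simp only [hg]
    rw [hGs, Nat.factorial_succ]
    push_cast
    field_simp
    ring
  set B : ℂ[X] := ∑ l ∈ Finset.range (n + 1), C (g l) * (X ^ l * shiftedLag α n y l) with hB
  have hop : laguerreOp α n B = 0 := by
    have hlin : laguerreOp α n B = ∑ l ∈ Finset.range (n + 1),
        laguerreOp α n (C (g l) * (X ^ l * shiftedLag α n y l)) := by
      simp only [hB, laguerreOp, derivative_sum, Finset.mul_sum, Finset.sum_add_distrib]
    set U : ℕ → ℂ[X] := fun l => C (g l * (l * (l + α))) * (X ^ l * shiftedLag α n y l) with hU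
    have hterm : ∀ l ∈ Finset.range (n + 1),
        laguerreOp α n (C (g l) * (X ^ l * shiftedLag α n y l)) = U l - U (l + 1) := by
      intro l hl
      rw [laguerreOp_term α n y (g l) (Nat.lt_succ_iff.1 (Finset.mem_range.1 hl)), ← hgs l]
    -- `U 0` has the factor `l = 0`, and `U (n + 1)` has the vanishing polynomial `shiftedLag`.
    rw [hlin, Finset.sum_congr rfl hterm, Finset.sum_range_sub']
    simp [hU, shiftedLag]
  -- Only the term `l = 0` contributes to the value at the origin.
  have hB0 : B.coeff 0 = (n.factorial : ℂ) / Complex.Gamma (n + α + 1) * (lagPoly α n).eval y *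
      (lagPoly α n).coeff 0 := by
    have hr : (lagPoly α n).coeff 0 * ((n.factorial : ℂ) * Complex.Gamma (α + 1)) =
        Complex.Gamma (n + α + 1) := by
      have h6 := Complex.Gamma_add_nat_div_Gamma_eq (n := n) (α + 1) (fun k h => hne k (by
        linear_combination h))
      have h7 : Complex.Gamma (α + 1) ≠ 0 := by simpa using hG 0
      rw [coeff_lagPoly, if_pos (Nat.zero_le n), risingCoeff]
      rw [div_eq_iff h7] at h6
      rw [show (n : ℂ) + α + 1 = α + 1 + n by ring, h6]
      have := hfac n
      simp only [pow_zero, Nat.factorial_zero, Nat.cast_one, Nat.cast_zero, add_zero,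
        Nat.sub_zero]
      field_simp
    rw [hB, finsetSum_coeff, Finset.sum_range_succ']
    have hz : ∑ l ∈ Finset.range n,
        (C (g (l + 1)) * (X ^ (l + 1) * shiftedLag α n y (l + 1))).coeff 0 = 0 :=
      Finset.sum_eq_zero fun l _ => by simp [coeff_zero_eq_eval_zero]
    have h7 : Complex.Gamma (α + 1) ≠ 0 := by simpa using hG 0
    have h8 := hG n
    rw [hz, zero_add]
    simp only [hg, coeff_zero_eq_eval_zero, shiftedLag] at hr ⊢
    rw [← hr] at h8 ⊢
    have h9 : eval 0 (lagPoly α n) ≠ 0 := fun h => h8 (by rw [h, zero_mul])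
    have := hfac n
    simp [eval_comp]
    field_simp
  have hfin := congrArg (eval x) (eq_smul_lagPoly_of_laguerreOp_eq_zero hne hop hB0)
  rw [eval_mul, eval_C] at hfin
  rw [show ∀ a b c : ℂ, a * (b * c) = a * c * b from fun a b c => by ring, ← hfin, hB,
    eval_finsetSum]
  refine Finset.sum_congr rfl fun l hl => ?_
  rw [shiftedLag, if_pos (Nat.lt_succ_iff.1 (Finset.mem_range.1 hl))]
  simp only [hg, eval_mul, eval_C, eval_pow, eval_X, eval_comp, eval_add]
  rw [mul_pow]
  ring

/-! ### Ultraspherical polynomials of complex type -/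

theorem Gamma_add_nat {z : ℂ} (hz : 0 < z.re) (n : ℕ) :
    Complex.Gamma (z + n) = (ascPochhammer ℂ n).eval z * Complex.Gamma z := by
  have h := Complex.Gamma_add_nat_div_Gamma_eq (n := n) z (fun k hk => by
    rw [hk] at hz
    simp at hz
    linarith [(Nat.cast_nonneg k : (0 : ℝ) ≤ k)])
  rw [← h, div_mul_cancel₀ _ (Complex.Gamma_ne_zero_of_re_pos hz)]

theorem ascPochhammer_eval_ne_zero {z : ℂ} (hz : 0 < z.re) (n : ℕ) :
    (ascPochhammer ℂ n).eval z ≠ 0 := by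
  intro h
  have h1 := Gamma_add_nat hz n
  rw [h, zero_mul] at h1
  refine Complex.Gamma_ne_zero_of_re_pos (s := z + n) ?_ h1
  simp only [Complex.add_re, Complex.natCast_re]
  linarith [(Nat.cast_nonneg n : (0 : ℝ) ≤ n)]

/-- The coefficients of the expansion of the ultraspherical polynomial of complex type `ν` in
products of powers of `u` and `1 - u²`. -/
def gegenbauerCoeff (ν : ℂ) (m k : ℕ) : ℂ :=
  (m.choose (2 * k) : ℂ) * (-1) ^ k * (ascPochhammer ℂ k).eval (1 / 2) /
    (ascPochhammer ℂ k).eval (ν + 1 / 2)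

/-- The two-variable form of the ultraspherical polynomial of complex type `ν`: the polynomial
itself is its value at `w = 1 - u²`, and its homogenization `s^m P_m(u / s)` is its value at
`w = s² - u²`. -/
def gegenbauerForm (ν : ℂ) (m : ℕ) (u w : ℂ) : ℂ :=
  ∑ k ∈ Finset.range (m + 1), gegenbauerCoeff ν m k * u ^ (m - 2 * k) * w ^ k

theorem gegenbauerCoeff_eq_zero (ν : ℂ) {m k : ℕ} (h : m < 2 * k) : gegenbauerCoeff ν m k = 0 := by
  simp [gegenbauerCoeff, Nat.choose_eq_zero_of_lt h]

theorem gegenbauerForm_eq_sum (ν : ℂ) {m M : ℕ} (hM : m ≤ M) (u w : ℂ) :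
    gegenbauerForm ν m u w =
      ∑ k ∈ Finset.range (M + 1), gegenbauerCoeff ν m k * u ^ (m - 2 * k) * w ^ k := by
  refine Finset.sum_subset (Finset.range_mono (by omega)) fun k _ hk => ?_
  rw [Finset.mem_range] at hk
  rw [gegenbauerCoeff_eq_zero ν (by omega), zero_mul, zero_mul]

/-- The truncated exponents `m - 2 k` obey the rule of exponents, since the coefficient vanishes
where truncation occurs. -/
theorem gegenbauerCoeff_mul_pow (ν : ℂ) (m k j : ℕ) (u : ℂ) :
    gegenbauerCoeff ν m k * u ^ (m + j - 2 * k) =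
      gegenbauerCoeff ν m k * (u ^ j * u ^ (m - 2 * k)) := by
  by_cases h : m < 2 * k
  · rw [gegenbauerCoeff_eq_zero ν h, zero_mul, zero_mul]
  · rw [← pow_add]
    congr 2
    omega

theorem cast_choose_succ (m j : ℕ) :
    ((j : ℂ) + 1) * (m.choose (j + 1) : ℂ) = ((m : ℂ) - j) * (m.choose j : ℂ) := by
  rcases le_or_gt j m with h | h
  · have := Nat.choose_succ_right_eq m j
    have h2 := congrArg (fun n : ℕ => (n : ℂ)) this
    push_cast [Nat.cast_sub h] at h2
    linear_combination h2
  · rw [Nat.choose_eq_zero_of_lt h, Nat.choose_eq_zero_of_lt (by omega)]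
    simp

theorem gegenbauerCoeff_recurrence {ν : ℂ} (hν : 0 < (ν + 1 / 2).re) (m k : ℕ) :
    ((m : ℂ) + 1 + 2 * ν) * gegenbauerCoeff ν (m + 2) (k + 1) -
      2 * ((m : ℂ) + 1 + ν) * gegenbauerCoeff ν (m + 1) (k + 1) +
      ((m : ℂ) + 1) * gegenbauerCoeff ν m (k + 1) = -(((m : ℂ) + 1) * gegenbauerCoeff ν m k) := by
  have hB := cast_choose_succ m (2 * k)
  have e1 : (m + 2).choose (2 * (k + 1)) =
      m.choose (2 * k) + 2 * m.choose (2 * k + 1) + m.choose (2 * k + 2) := by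
    rw [show 2 * (k + 1) = 2 * k + 1 + 1 by ring, Nat.choose_succ_succ, Nat.choose_succ_succ,
      Nat.choose_succ_succ]
    simp only [Nat.succ_eq_add_one]
    ring
  have e2 : (m + 1).choose (2 * (k + 1)) = m.choose (2 * k + 1) + m.choose (2 * k + 2) := by
    rw [show 2 * (k + 1) = 2 * k + 1 + 1 by ring, Nat.choose_succ_succ]
  have n1 := ascPochhammer_eval_ne_zero hν k
  have n2 : ν + 1 / 2 + k ≠ 0 := by
    have := ascPochhammer_eval_ne_zero hν (k + 1)
    rw [ascPochhammer_succ_eval] at this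
    exact right_ne_zero_of_mul this
  have n3 : (2 * (k : ℂ) + 1) ≠ 0 := by exact_mod_cast (by omega : 2 * k + 1 ≠ 0)
  have hB' : (m.choose (2 * k + 1) : ℂ) =
      ((m : ℂ) - 2 * k) * (m.choose (2 * k) : ℂ) / (2 * k + 1) := by
    rw [eq_div_iff n3]
    push_cast at hB
    linear_combination hB
  simp only [gegenbauerCoeff, ascPochhammer_succ_eval]
  rw [e1, e2, show 2 * (k + 1) = 2 * k + 2 by ring]
  push_cast
  rw [hB']
  generalize (m.choose (2 * k) : ℂ) = A at *
  generalize (m.choose (2 * k + 2) : ℂ) = E at *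
  generalize eval (ν + 1 / 2) (ascPochhammer ℂ k) = x at *
  generalize eval (1 / 2) (ascPochhammer ℂ k) = z at *
  obtain ⟨h, hh⟩ : ∃ h, h = ν + 1 / 2 + (k : ℂ) := ⟨_, rfl⟩
  rw [← hh] at n2 ⊢
  obtain rfl : ν = h - 1 / 2 - k := by rw [hh]; ring
  field_simp
  ring

/-- The homogenized three-term recurrence, in which `u² + w` plays the role of `s²`. -/
theorem gegenbauerForm_recurrence {ν : ℂ} (hν : 0 < (ν + 1 / 2).re) (m : ℕ) (u w : ℂ) :
    ((m : ℂ) + 1 + 2 * ν) * gegenbauerForm ν (m + 2) u w =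
      2 * ((m : ℂ) + 1 + ν) * u * gegenbauerForm ν (m + 1) u w -
        ((m : ℂ) + 1) * (u ^ 2 + w) * gegenbauerForm ν m u w := by
  -- On the left the coefficient of `w^0` cancels, so both sides are sums over `w^(k + 1)`.
  have key : ((m : ℂ) + 1 + 2 * ν) * gegenbauerForm ν (m + 2) u w -
      2 * ((m : ℂ) + 1 + ν) * u * gegenbauerForm ν (m + 1) u w +
        ((m : ℂ) + 1) * u ^ 2 * gegenbauerForm ν m u w =
      -(((m : ℂ) + 1) * w * gegenbauerForm ν m u w) := by
    rw [gegenbauerForm_eq_sum ν (le_refl (m + 2)), gegenbauerForm_eq_sum ν (Nat.le_succ (m + 1)),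
      gegenbauerForm_eq_sum ν (by omega : m ≤ m + 2), Finset.mul_sum, Finset.mul_sum,
      Finset.mul_sum, ← Finset.sum_sub_distrib, ← Finset.sum_add_distrib, Finset.sum_range_succ',
      ← gegenbauerForm_eq_sum ν (by omega : m ≤ m + 2),
      gegenbauerForm_eq_sum ν (by omega : m ≤ m + 1), Finset.mul_sum, ← Finset.sum_neg_distrib]
    have h0 : ∀ n : ℕ, gegenbauerCoeff ν n 0 = 1 := fun n => by simp [gegenbauerCoeff]
    have hz : ∀ a b : ℂ, b = 0 → a + b = a := fun a b h => by rw [h, add_zero]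
    rw [hz]
    · refine Finset.sum_congr rfl fun k _ => ?_
      have h1 := gegenbauerCoeff_mul_pow ν (m + 1) (k + 1) 1 u
      have h2 := gegenbauerCoeff_mul_pow ν m (k + 1) 2 u
      have h3 := gegenbauerCoeff_recurrence hν m k
      rw [show m + 1 + 1 - 2 * (k + 1) = m - 2 * k by omega] at h1
      rw [show m + 2 - 2 * (k + 1) = m - 2 * k by omega] at h2 ⊢
      linear_combination u ^ (m - 2 * k) * w ^ (k + 1) * h3 +
        2 * ((m : ℂ) + 1 + ν) * w ^ (k + 1) * h1 - ((m : ℂ) + 1) * w ^ (k + 1) * h2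
    · simp only [h0, Nat.mul_zero, Nat.sub_zero]
      ring
  linear_combination key

/-- The homogenized ultraspherical polynomial `s^m P_m^a(u / s)` in powers of `u` and `s² - u²`. -/
theorem ultraspherical_eq_gegenbauerForm {a : ℝ} (ha : 0 ≤ a) (m : ℕ) (u : ℝ) {s : ℝ}
    (hs : s ≠ 0) :
    (s : ℂ) ^ m * (ultraspherical a m (u / s) : ℂ) =
      gegenbauerForm a m u ((s : ℂ) ^ 2 - (u : ℂ) ^ 2) := by
  have hs' : (s : ℂ) ≠ 0 := Complex.ofReal_ne_zero.2 hs
  have hν : 0 < ((a : ℂ) + 1 / 2).re := by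
    simp
    linarith
  induction m using Nat.twoStepInduction with
  | zero => simp [ultraspherical, gegenbauerForm, gegenbauerCoeff]
  | one =>
    simp [ultraspherical, gegenbauerForm, gegenbauerCoeff, Finset.sum_range_succ]
    field_simp
  | more m ih1 ih2 =>
    have h := gegenbauerForm_recurrence hν m u ((s : ℂ) ^ 2 - (u : ℂ) ^ 2)
    have hm : ((m : ℂ) + 1 + 2 * a) ≠ 0 := by
      have : ((m : ℝ) + 1 + 2 * a) ≠ 0 := by positivity
      exact_mod_cast this
    rw [← ih1, ← ih2] at h
    refine mul_left_cancel₀ hm ?_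
    rw [h, ultraspherical]
    push_cast
    field_simp
    ring

/-! ### The functions `Q` in closed form -/

/-- The integrand of `Q` in the variable `v = (s² - u²) / (1 - u²)`, up to the Jacobian; the factor
`s^(m + 1)` is split between the homogenization of the polynomial and the Jacobian. -/
theorem regQ_integrand_eq {a : ℝ} (ha : 0 ≤ a) (μ : ℂ) (m : ℕ) {u s : ℝ} (hu : |u| < 1)
    (hs : s ∈ Set.Ioo |u| 1) :
    ((ultraspherical a m (u / s) * (s ^ 2 - u ^ 2) ^ (a - 1 / 2) : ℝ) : ℂ) *
        ((1 - s ^ 2 : ℝ) : ℂ) ^ (μ - 1) * (s : ℂ) ^ (m + 1) =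
      |2 * s / (1 - u ^ 2)| • (1 / 2 * ((1 - u ^ 2 : ℝ) : ℂ) ^ ((a : ℂ) + μ - 1 / 2) *
        ∑ k ∈ Finset.range (m + 1), gegenbauerCoeff a m k * (u : ℂ) ^ (m - 2 * k) *
          ((1 - u ^ 2 : ℝ) : ℂ) ^ k *
          ((((s ^ 2 - u ^ 2) / (1 - u ^ 2) : ℝ) : ℂ) ^ ((a : ℂ) + 1 / 2 + k - 1) *
            (1 - (((s ^ 2 - u ^ 2) / (1 - u ^ 2) : ℝ) : ℂ)) ^ (μ - 1))) := by
  have hs0 : 0 < s := (abs_nonneg u).trans_lt hs.1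
  have hc : 0 < 1 - u ^ 2 := by
    have := (sq_lt_one_iff_abs_lt_one u).2 hu
    linarith
  have hsu : 0 < s ^ 2 - u ^ 2 := by
    have := sq_lt_sq.2 (hs.1.trans_le (le_abs_self s))
    linarith
  have hs1 : 0 < 1 - s ^ 2 := by nlinarith [hs.2]
  set c := 1 - u ^ 2 with hcdef
  set v := (s ^ 2 - u ^ 2) / c with hv
  have hvpos : 0 < v := div_pos hsu hc
  have hcv : c * v = s ^ 2 - u ^ 2 := by rw [hv]; field_simp
  have h1v : 1 - s ^ 2 = c * (1 - v) := by rw [mul_sub, hcv]; ring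
  have h1vpos : 0 < 1 - v := by
    by_contra hcon
    have := mul_nonpos_of_nonneg_of_nonpos hc.le (not_lt.1 hcon)
    linarith
  have hc' : (c : ℂ) ≠ 0 := Complex.ofReal_ne_zero.2 hc.ne'
  have hv' : (v : ℂ) ≠ 0 := Complex.ofReal_ne_zero.2 hvpos.ne'
  have hform := ultraspherical_eq_gegenbauerForm ha m u hs0.ne'
  have hw : (s : ℂ) ^ 2 - (u : ℂ) ^ 2 = (c : ℂ) * v := by
    rw [← Complex.ofReal_mul, hcv]; push_cast; ring
  rw [hw, gegenbauerForm] at hform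
  have hsum : ∑ k ∈ Finset.range (m + 1), gegenbauerCoeff a m k * (u : ℂ) ^ (m - 2 * k) *
          (c : ℂ) ^ k * ((v : ℂ) ^ ((a : ℂ) + 1 / 2 + k - 1) * (1 - (v : ℂ)) ^ (μ - 1)) =
      (v : ℂ) ^ ((a : ℂ) - 1 / 2) * (1 - (v : ℂ)) ^ (μ - 1) *
        ((s : ℂ) ^ m * (ultraspherical a m (u / s) : ℂ)) := by
    rw [hform, Finset.mul_sum]
    refine Finset.sum_congr rfl fun k _ => ?_
    rw [show (a : ℂ) + 1 / 2 + k - 1 = (a - 1 / 2) + k by ring, Complex.cpow_add _ _ hv',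
      Complex.cpow_natCast, mul_pow]
    ring
  rw [hsum, abs_of_pos (by positivity), ← hcv, h1v, Complex.real_smul,
    Real.mul_rpow hc.le hvpos.le]
  push_cast [Complex.ofReal_cpow hc.le, Complex.ofReal_cpow hvpos.le]
  have hm : ((c : ℂ) * (1 - (v : ℂ))) ^ (μ - 1) = (c : ℂ) ^ (μ - 1) * (1 - (v : ℂ)) ^ (μ - 1) := by
    have := Complex.mul_cpow_ofReal_nonneg hc.le h1vpos.le (μ - 1)
    push_cast at this
    exact this
  have hexp : (c : ℂ) ^ ((a : ℂ) + μ - 1 / 2) =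
      (c : ℂ) ^ ((a : ℂ) - 1 / 2) * (c : ℂ) ^ (μ - 1) * c := by
    rw [← Complex.cpow_add _ _ hc', show (a : ℂ) + μ - 1 / 2 = (a - 1 / 2 + (μ - 1)) + 1 by ring,
      Complex.cpow_add _ _ hc', Complex.cpow_one]
  rw [hm, hexp, pow_succ]
  field_simp

/-- For `|u| < 1` the substitution `s² = u² + (1 - u²) v` turns the integral defining `Q` into Beta
integrals, and their sum is an ultraspherical polynomial whose type is complex. -/
theorem regQ_eq {lam : ℂ} (hl : 0 ≤ lam.re) (m : ℕ) {η u : ℝ} (hη : 0 < η) (hu : |u| < 1) :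
    regQ m lam η u = 1 / 2 * (Complex.Gamma (lam.re + 1 / 2) / Complex.Gamma (lam + η + 1 / 2)) *
      ((1 - u ^ 2 : ℝ) : ℂ) ^ (lam + η - 1 / 2) *
        gegenbauerForm (lam + η) m u ((1 - u ^ 2 : ℝ) : ℂ) := by
  set a := lam.re with ha
  set μ : ℂ := lam.im * Complex.I + η with hμ
  have hμre : 0 < μ.re := by simp [hμ, hη]
  have hlam : (a : ℂ) + μ = lam + η := by
    rw [hμ, ← add_assoc, ha, Complex.re_add_im]
  have hc : 0 < 1 - u ^ 2 := by
    have := (sq_lt_one_iff_abs_lt_one u).2 hu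
    linarith
  set f : ℝ → ℝ := fun s => (s ^ 2 - u ^ 2) / (1 - u ^ 2) with hf
  set g : ℝ → ℂ := fun v => 1 / 2 * ((1 - u ^ 2 : ℝ) : ℂ) ^ ((a : ℂ) + μ - 1 / 2) *
        ∑ k ∈ Finset.range (m + 1), gegenbauerCoeff a m k * (u : ℂ) ^ (m - 2 * k) *
          ((1 - u ^ 2 : ℝ) : ℂ) ^ k *
          ((v : ℂ) ^ ((a : ℂ) + 1 / 2 + k - 1) * (1 - (v : ℂ)) ^ (μ - 1)) with hg
  have himg : f '' Set.Ioo |u| 1 = Set.Ioo 0 1 := by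
    ext v
    constructor
    · rintro ⟨s, hs, rfl⟩
      have hs0 : 0 < s := (abs_nonneg u).trans_lt hs.1
      have hsu : 0 < s ^ 2 - u ^ 2 := by
        have := sq_lt_sq.2 (hs.1.trans_le (le_abs_self s))
        linarith
      refine ⟨div_pos hsu hc, (div_lt_one hc).2 ?_⟩
      nlinarith [hs.2]
    · rintro ⟨h0, h1⟩
      have hp : 0 < (1 - u ^ 2) * v := mul_pos hc h0
      have hq : (1 - u ^ 2) * v < 1 - u ^ 2 := by nlinarith
      refine ⟨√(u ^ 2 + (1 - u ^ 2) * v), ⟨?_, ?_⟩, ?_⟩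
      · rw [← Real.sqrt_sq_eq_abs]
        exact Real.sqrt_lt_sqrt (sq_nonneg u) (by linarith)
      · rw [Real.sqrt_lt' one_pos]
        linarith
      · simp only [hf]
        rw [Real.sq_sqrt (by positivity)]
        field_simp
        ring
  have hderiv : ∀ s ∈ Set.Ioo |u| 1,
      HasDerivWithinAt f (2 * s / (1 - u ^ 2)) (Set.Ioo |u| 1) s := by
    intro s _
    have := (((hasDerivAt_id s).pow 2).sub_const (u ^ 2)).div_const (1 - u ^ 2)
    simpa [hf] using this.hasDerivWithinAt
  have hinj : Set.InjOn f (Set.Ioo |u| 1) := by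
    intro s hs t ht hst
    have hs0 : 0 < s := (abs_nonneg u).trans_lt hs.1
    have ht0 : 0 < t := (abs_nonneg u).trans_lt ht.1
    simp only [hf] at hst
    rw [div_left_inj' hc.ne'] at hst
    exact (sq_eq_sq₀ hs0.le ht0.le).1 (by linarith)
  have hint : ∫ s in Set.Icc |u| 1,
      ((ultraspherical a m (u / s) * (s ^ 2 - u ^ 2) ^ (a - 1 / 2) : ℝ) : ℂ) *
        ((1 - s ^ 2 : ℝ) : ℂ) ^ (μ - 1) * (s : ℂ) ^ (m + 1) = ∫ v in Set.Ioo (0 : ℝ) 1, g v := by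
    rw [integral_Icc_eq_integral_Ioo, ← himg,
      integral_image_eq_integral_abs_deriv_smul measurableSet_Ioo hderiv hinj]
    exact setIntegral_congr_fun measurableSet_Ioo fun s hs => regQ_integrand_eq hl μ m hu hs
  have hre : ∀ k : ℕ, 0 < ((a : ℂ) + 1 / 2 + k).re := by
    intro k
    have : (0 : ℝ) ≤ k := k.cast_nonneg
    simp
    linarith
  have hbeta : ∫ v in Set.Ioo (0 : ℝ) 1, g v =
      1 / 2 * ((1 - u ^ 2 : ℝ) : ℂ) ^ ((a : ℂ) + μ - 1 / 2) *
        ∑ k ∈ Finset.range (m + 1), gegenbauerCoeff a m k * (u : ℂ) ^ (m - 2 * k) *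
          ((1 - u ^ 2 : ℝ) : ℂ) ^ k * Complex.betaIntegral ((a : ℂ) + 1 / 2 + k) μ := by
    rw [← integral_Ioc_eq_integral_Ioo, ← intervalIntegral.integral_of_le zero_le_one]
    simp only [hg]
    rw [intervalIntegral.integral_const_mul, intervalIntegral.integral_finsetSum]
    · congr 1
      refine Finset.sum_congr rfl fun k _ => ?_
      rw [intervalIntegral.integral_const_mul, Complex.betaIntegral]
    · intro k _
      exact (Complex.betaIntegral_convergent (hre k) hμre).const_mul _
  have hre2 : 0 < ((a : ℂ) + 1 / 2).re := by simpa using hre 0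
  have hre3 : 0 < (lam + η + 1 / 2).re := by
    simp
    linarith
  -- The Beta integral replaces the Pochhammer symbol of type `a` by the one of type `λ + η`.
  have hterm : ∀ k : ℕ, gegenbauerCoeff a m k * Complex.betaIntegral ((a : ℂ) + 1 / 2 + k) μ =
      Complex.Gamma μ * (Complex.Gamma (a + 1 / 2) / Complex.Gamma (lam + η + 1 / 2)) *
        gegenbauerCoeff (lam + η) m k := by
    intro k
    have n1 := ascPochhammer_eval_ne_zero hre2 k
    have n2 := ascPochhammer_eval_ne_zero hre3 k
    have n3 := Complex.Gamma_ne_zero_of_re_pos hre3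
    rw [Complex.betaIntegral_eq_Gamma_mul_div _ _ (hre k) hμre,
      show (a : ℂ) + 1 / 2 + k + μ = (lam + η + 1 / 2) + k by rw [← hlam]; ring,
      Gamma_add_nat hre2, Gamma_add_nat hre3, gegenbauerCoeff, gegenbauerCoeff]
    generalize (ascPochhammer ℂ k).eval ((a : ℂ) + 1 / 2) = A at *
    generalize (ascPochhammer ℂ k).eval (lam + η + 1 / 2) = B at *
    generalize Complex.Gamma (lam + η + 1 / 2) = G at *
    field_simp
  rw [regQ, hint, hbeta, gegenbauerForm, hlam]
  have hsum : ∑ k ∈ Finset.range (m + 1), gegenbauerCoeff a m k * (u : ℂ) ^ (m - 2 * k) *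
      ((1 - u ^ 2 : ℝ) : ℂ) ^ k * Complex.betaIntegral ((a : ℂ) + 1 / 2 + k) μ =
      Complex.Gamma μ * (Complex.Gamma (a + 1 / 2) / Complex.Gamma (lam + η + 1 / 2)) *
        ∑ k ∈ Finset.range (m + 1), gegenbauerCoeff (lam + η) m k * (u : ℂ) ^ (m - 2 * k) *
          ((1 - u ^ 2 : ℝ) : ℂ) ^ k := by
    rw [Finset.mul_sum]
    refine Finset.sum_congr rfl fun k _ => ?_
    linear_combination (u : ℂ) ^ (m - 2 * k) * ((1 - u ^ 2 : ℝ) : ℂ) ^ k * hterm k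
  have n4 := Complex.Gamma_ne_zero_of_re_pos hμre
  rw [hsum, ← hμ]
  field_simp

/-- At the endpoints the interval of integration is a point. -/
theorem regQ_eq_zero (lam : ℂ) (m : ℕ) (η : ℝ) {u : ℝ} (hu : |u| = 1) : regQ m lam η u = 0 := by
  rw [regQ, hu, Set.Icc_self]
  simp

/-- The closed form of `Q_m^λ` on `(-1, 1)`: a multiple of `(1 - u²)^(λ - 1/2) P_m^λ(u)`. -/
def closedQ (m : ℕ) (lam : ℂ) (u : ℝ) : ℂ :=
  1 / 2 * (Complex.Gamma (lam.re + 1 / 2) / Complex.Gamma (lam + 1 / 2)) *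
    ((1 - u ^ 2 : ℝ) : ℂ) ^ (lam - 1 / 2) * gegenbauerForm lam m u ((1 - u ^ 2 : ℝ) : ℂ)

theorem tendsto_regQ {lam : ℂ} (hl : 0 ≤ lam.re) (m : ℕ) {u : ℝ} (hu : |u| < 1) :
    Tendsto (fun η => regQ m lam η u) (𝓝[>] 0) (𝓝 (closedQ m lam u)) := by
  have hc : ((1 - u ^ 2 : ℝ) : ℂ) ≠ 0 := by
    have := (sq_lt_one_iff_abs_lt_one u).2 hu
    exact Complex.ofReal_ne_zero.2 (by linarith)
  have hre : 0 < (lam + ((0 : ℝ) : ℂ) + 1 / 2).re := by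
    simp
    linarith
  set F : ℝ → ℂ := fun η => 1 / 2 *
    (Complex.Gamma (lam.re + 1 / 2) / Complex.Gamma (lam + η + 1 / 2)) *
      ((1 - u ^ 2 : ℝ) : ℂ) ^ (lam + η - 1 / 2) *
        gegenbauerForm (lam + η) m u ((1 - u ^ 2 : ℝ) : ℂ) with hF
  have hGne : Complex.Gamma (lam + ((0 : ℝ) : ℂ) + 1 / 2) ≠ 0 :=
    Complex.Gamma_ne_zero_of_re_pos hre
  have hGc : ContinuousAt (fun η : ℝ => Complex.Gamma (lam + η + 1 / 2)) 0 := by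
    refine ContinuousAt.comp (f := fun η : ℝ => lam + (η : ℂ) + 1 / 2) ?_ (by fun_prop)
    refine (Complex.differentiableAt_Gamma _ fun k hk => ?_).continuousAt
    rw [hk] at hre
    simp at hre
    linarith [(Nat.cast_nonneg k : (0 : ℝ) ≤ k)]
  have hcont : ContinuousAt F 0 := by
    refine ((continuousAt_const.mul (continuousAt_const.div hGc hGne)).mul ?_).mul ?_
    · exact ContinuousAt.const_cpow (by fun_prop) (Or.inl hc)
    · simp only [gegenbauerForm, gegenbauerCoeff]
      refine tendsto_finsetSum _ fun k _ => ?_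
      have hp : ContinuousAt
          (fun η : ℝ => (ascPochhammer ℂ k).eval (lam + η + 1 / 2)) 0 :=
        ((ascPochhammer ℂ k).continuous.comp (by fun_prop)).continuousAt
      exact ((ContinuousAt.div continuousAt_const hp
        (ascPochhammer_eval_ne_zero hre k)).mul continuousAt_const).mul continuousAt_const
  have h0 : F 0 = closedQ m lam u := by simp [hF, closedQ]
  rw [← h0]
  refine (hcont.tendsto.mono_left nhdsWithin_le_nhds).congr' ?_
  filter_upwards [self_mem_nhdsWithin] with η hη
  exact (regQ_eq hl m hη hu).symm

theorem funQ_eq {lam : ℂ} (hl : 0 ≤ lam.re) (m : ℕ) {u : ℝ} (hu : |u| < 1) :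
    funQ m lam u = closedQ m lam u :=
  (tendsto_regQ hl m hu).limUnder_eq

theorem tendsto_regQ_funQ {lam : ℂ} (hl : 0 ≤ lam.re) (m : ℕ) {u : ℝ}
    (hu : u ∈ Set.Icc (-1 : ℝ) 1) :
    Tendsto (fun η => regQ m lam η u) (𝓝[>] 0) (𝓝 (funQ m lam u)) := by
  rcases (abs_le.2 hu).lt_or_eq with h | h
  · rw [funQ_eq hl m h]
    exact tendsto_regQ hl m h
  · have : Tendsto (fun η => regQ m lam η u) (𝓝[>] 0) (𝓝 0) := by
      simp only [regQ_eq_zero lam m _ h]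
      exact tendsto_const_nhds
    rwa [funQ, this.limUnder_eq]

/-! ### Moments of the functions `Q` -/

/-- The ultraspherical weight `(1 - u²)^(ν - 1/2)` of complex type `ν`. -/
def ultraWeight (ν : ℂ) (u : ℝ) : ℂ := ((1 - u ^ 2 : ℝ) : ℂ) ^ (ν - 1 / 2)

/-- In the variable `(u + 1) / 2` the weight is the integrand of a Beta integral. -/
theorem ultraWeight_eq_beta (ν : ℂ) {u : ℝ} (hu : u ∈ Set.Icc (-1 : ℝ) 1) :
    ultraWeight ν u = (4 : ℂ) ^ (ν - 1 / 2) *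
      (((u / 2 + 1 / 2 : ℝ) : ℂ) ^ (ν + 1 / 2 - 1) *
        (1 - ((u / 2 + 1 / 2 : ℝ) : ℂ)) ^ (ν + 1 / 2 - 1)) := by
  have h1 : 0 ≤ u / 2 + 1 / 2 := by linarith [hu.1]
  have h2 : 0 ≤ 1 - (u / 2 + 1 / 2) := by linarith [hu.2]
  have e : 1 - u ^ 2 = 4 * ((u / 2 + 1 / 2) * (1 - (u / 2 + 1 / 2))) := by ring
  rw [ultraWeight, e, Complex.ofReal_mul, Complex.mul_cpow_ofReal_nonneg (by norm_num)
    (mul_nonneg h1 h2), Complex.ofReal_mul, Complex.mul_cpow_ofReal_nonneg h1 h2,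
    show ν + 1 / 2 - 1 = ν - 1 / 2 by ring]
  push_cast
  rfl

theorem re_add_half_pos {ν : ℂ} (hν : 0 ≤ ν.re) : 0 < (ν + 1 / 2).re := by
  simp
  linarith

theorem re_add_one_nonneg {ν : ℂ} (hν : 0 ≤ ν.re) : 0 ≤ (ν + 1).re := by
  simp
  linarith

theorem intervalIntegrable_ultraWeight {ν : ℂ} (hν : 0 ≤ ν.re) :
    IntervalIntegrable (ultraWeight ν) volume (-1) 1 := by
  have h := Complex.betaIntegral_convergent (re_add_half_pos hν) (re_add_half_pos hν)
  have h1 := (h.comp_add_right (1 / 2)).comp_mul_left (c := 1 / 2)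
  have h2 := h1.const_mul ((4 : ℂ) ^ (ν - 1 / 2))
  norm_num at h2
  refine h2.congr_uIoo fun u hu => ?_
  rw [Set.uIoo_of_le (by norm_num)] at hu
  rw [ultraWeight_eq_beta ν ⟨hu.1.le, hu.2.le⟩]
  push_cast
  ring_nf

/-- The total mass of the weight, by the Beta integral and the duplication formula. -/
theorem integral_ultraWeight {ν : ℂ} (hν : 0 ≤ ν.re) :
    (∫ u in (-1 : ℝ)..1, ultraWeight ν u) * Complex.Gamma (ν + 1) =
      (√Real.pi : ℂ) * Complex.Gamma (ν + 1 / 2) := by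
  have hre := re_add_half_pos hν
  have h1 : ∫ u in (-1 : ℝ)..1, ultraWeight ν u =
      (4 : ℂ) ^ (ν - 1 / 2) * (2 * Complex.betaIntegral (ν + 1 / 2) (ν + 1 / 2)) := by
    rw [intervalIntegral.integral_congr (g := fun u => (4 : ℂ) ^ (ν - 1 / 2) *
      (((u / 2 + 1 / 2 : ℝ) : ℂ) ^ (ν + 1 / 2 - 1) *
        (1 - ((u / 2 + 1 / 2 : ℝ) : ℂ)) ^ (ν + 1 / 2 - 1)))
      (fun u hu => ultraWeight_eq_beta ν (by rwa [Set.uIcc_of_le (by norm_num)] at hu)),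
      intervalIntegral.integral_const_mul]
    congr 1
    have := intervalIntegral.integral_comp_div_add (a := -1) (b := 1) (c := 2)
      (fun x : ℝ => (x : ℂ) ^ (ν + 1 / 2 - 1) * (1 - (x : ℂ)) ^ (ν + 1 / 2 - 1)) two_ne_zero (1 / 2)
    rw [this, Complex.betaIntegral]
    norm_num
  have hd := Complex.Gamma_mul_Gamma_add_half (ν + 1 / 2)
  rw [show ν + 1 / 2 + 1 / 2 = ν + 1 by ring,
    show 2 * (ν + 1 / 2) = ν + 1 / 2 + (ν + 1 / 2) by ring] at hd
  have h4 : (4 : ℂ) ^ (ν - 1 / 2) * (2 * (2 : ℂ) ^ (1 - (ν + 1 / 2 + (ν + 1 / 2)))) = 1 := by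
    have e4 : (4 : ℂ) ^ (ν - 1 / 2) = (2 : ℂ) ^ (ν - 1 / 2) * (2 : ℂ) ^ (ν - 1 / 2) := by
      have := Complex.mul_cpow_ofReal_nonneg (a := 2) (b := 2) (by norm_num) (by norm_num)
        (ν - 1 / 2)
      push_cast at this
      rw [← this]
      norm_num
    have e2 : (2 : ℂ) = (2 : ℂ) ^ (1 : ℂ) := by simp
    have hne : (2 : ℂ) ≠ 0 := two_ne_zero
    calc (4 : ℂ) ^ (ν - 1 / 2) * (2 * (2 : ℂ) ^ (1 - (ν + 1 / 2 + (ν + 1 / 2))))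
        = (2 : ℂ) ^ (ν - 1 / 2) * (2 : ℂ) ^ (ν - 1 / 2) *
          ((2 : ℂ) ^ (1 : ℂ) * (2 : ℂ) ^ (1 - (ν + 1 / 2 + (ν + 1 / 2)))) := by rw [e4, ← e2]
      _ = 1 := by
        rw [← Complex.cpow_add _ _ hne, ← Complex.cpow_add _ _ hne, ← Complex.cpow_add _ _ hne]
        rw [show ν - 1 / 2 + (ν - 1 / 2) + (1 + (1 - (ν + 1 / 2 + (ν + 1 / 2)))) = 0 by ring]
        simp
  have hG : Complex.Gamma (ν + 1 / 2 + (ν + 1 / 2)) ≠ 0 :=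
    Complex.Gamma_ne_zero_of_re_pos (by rw [Complex.add_re]; linarith)
  rw [h1, Complex.betaIntegral_eq_Gamma_mul_div _ _ hre hre]
  generalize Complex.Gamma (ν + 1 / 2 + (ν + 1 / 2)) = G at *
  generalize Complex.Gamma (ν + 1 / 2) = H at *
  generalize Complex.Gamma (ν + 1) = K at *
  generalize (4 : ℂ) ^ (ν - 1 / 2) = A at *
  generalize (2 : ℂ) ^ (1 - (ν + 1 / 2 + (ν + 1 / 2))) = B at *
  field_simp
  linear_combination 2 * A * H * hd + H * G * (√Real.pi : ℂ) * h4

/-- The algebraic part of the ladder relation for ultraspherical polynomials of types `ν + 1` and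
`ν`. -/
theorem gegenbauerForm_ladder {ν : ℂ} (hν : 0 < (ν + 1 / 2).re) (m : ℕ) (u c : ℂ) :
    c * (∑ k ∈ Finset.range (m + 1), gegenbauerCoeff (ν + 1) m k *
        (((m - 2 * k : ℕ) : ℂ) * u ^ (m - 2 * k - 1) * c ^ k +
          u ^ (m - 2 * k) * ((k : ℂ) * c ^ (k - 1) * (-2 * u)))) -
      (2 * ν + 1) * u * gegenbauerForm (ν + 1) m u c =
    -(2 * ν + 1) * gegenbauerForm ν (m + 1) u c := by
  have hc : ∀ k : ℕ, (k : ℂ) * c ^ (k - 1) * c = k * c ^ k := by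
    intro k
    cases k with
    | zero => simp
    | succ k => rw [Nat.add_sub_cancel, pow_succ]; ring
  have h1 : c * (∑ k ∈ Finset.range (m + 1), gegenbauerCoeff (ν + 1) m k *
        (((m - 2 * k : ℕ) : ℂ) * u ^ (m - 2 * k - 1) * c ^ k +
          u ^ (m - 2 * k) * ((k : ℂ) * c ^ (k - 1) * (-2 * u)))) -
      (2 * ν + 1) * u * gegenbauerForm (ν + 1) m u c =
      (∑ k ∈ Finset.range (m + 1), gegenbauerCoeff (ν + 1) m k *
        (((m - 2 * k : ℕ) : ℂ) * u ^ (m - 2 * k - 1) * c ^ (k + 1))) -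
      ∑ k ∈ Finset.range (m + 1 + 1),
        (2 * k + 2 * ν + 1) * (gegenbauerCoeff (ν + 1) m k * u ^ (m + 1 - 2 * k)) * c ^ k := by
    rw [Finset.sum_range_succ (n := m + 1), gegenbauerCoeff_eq_zero (k := m + 1) _ (by omega),
      gegenbauerForm, Finset.mul_sum, Finset.mul_sum, ← Finset.sum_sub_distrib, zero_mul, mul_zero,
      zero_mul, add_zero, ← Finset.sum_sub_distrib]
    refine Finset.sum_congr rfl fun k _ => ?_
    rw [gegenbauerCoeff_mul_pow]
    linear_combination (-2 * u) * gegenbauerCoeff (ν + 1) m k * u ^ (m - 2 * k) * hc k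
  have h0 : ∀ (ν : ℂ) (n : ℕ), gegenbauerCoeff ν n 0 = 1 := fun ν n => by simp [gegenbauerCoeff]
  rw [h1, gegenbauerForm, Finset.sum_range_succ' _ (m + 1), Finset.sum_range_succ' _ (m + 1),
    h0, h0]
  have h2 : (∑ k ∈ Finset.range (m + 1), gegenbauerCoeff (ν + 1) m k *
        (((m - 2 * k : ℕ) : ℂ) * u ^ (m - 2 * k - 1) * c ^ (k + 1))) -
      ∑ k ∈ Finset.range (m + 1), (2 * ((k + 1 : ℕ) : ℂ) + 2 * ν + 1) *
        (gegenbauerCoeff (ν + 1) m (k + 1) * u ^ (m + 1 - 2 * (k + 1))) * c ^ (k + 1) =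
      -(2 * ν + 1) * ∑ k ∈ Finset.range (m + 1),
        gegenbauerCoeff ν (m + 1) (k + 1) * u ^ (m + 1 - 2 * (k + 1)) * c ^ (k + 1) := by
    rw [← Finset.sum_sub_distrib, Finset.mul_sum]
    refine Finset.sum_congr rfl fun k _ => ?_
    rw [show m + 1 - 2 * (k + 1) = m - 2 * k - 1 by omega]
    have key : gegenbauerCoeff (ν + 1) m k * ((m - 2 * k : ℕ) : ℂ) -
        (2 * ((k + 1 : ℕ) : ℂ) + 2 * ν + 1) * gegenbauerCoeff (ν + 1) m (k + 1) =
        -(2 * ν + 1) * gegenbauerCoeff ν (m + 1) (k + 1) := by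
      have hB : gegenbauerCoeff (ν + 1) m k * ((m - 2 * k : ℕ) : ℂ) =
          (2 * k + 1) * (m.choose (2 * k + 1) : ℂ) * (-1) ^ k *
            (ascPochhammer ℂ k).eval (1 / 2) / (ascPochhammer ℂ k).eval (ν + 1 + 1 / 2) := by
        have := congrArg (fun n : ℕ => (n : ℂ)) (Nat.choose_succ_right_eq m (2 * k))
        push_cast at this
        rw [gegenbauerCoeff]
        linear_combination (-(-1) ^ k * (ascPochhammer ℂ k).eval (1 / 2) /
          (ascPochhammer ℂ k).eval (ν + 1 + 1 / 2)) * this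
      have hP : (ascPochhammer ℂ (k + 1)).eval (ν + 1 / 2) =
          (ν + 1 / 2) * (ascPochhammer ℂ k).eval (ν + 1 + 1 / 2) := by
        rw [ascPochhammer_succ_left, eval_mul, eval_comp]
        simp only [eval_X, eval_add, eval_one]
        rw [show ν + 1 / 2 + 1 = ν + 1 + 1 / 2 by ring]
      have hν1 : 0 < (ν + 1 + 1 / 2).re := by
        rw [show ν + 1 + 1 / 2 = ν + 1 / 2 + 1 by ring, Complex.add_re, Complex.one_re]
        linarith
      have n1 := ascPochhammer_eval_ne_zero hν1 k
      have n2 : ν + 1 + 1 / 2 + k ≠ 0 := by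
        have := ascPochhammer_eval_ne_zero hν1 (k + 1)
        rw [ascPochhammer_succ_eval] at this
        exact right_ne_zero_of_mul this
      have n3 : ν + 1 / 2 ≠ 0 := by
        rintro h
        rw [h] at hν
        simp at hν
      rw [hB, gegenbauerCoeff, gegenbauerCoeff, hP, ascPochhammer_succ_eval,
        ascPochhammer_succ_eval, show 2 * (k + 1) = 2 * k + 1 + 1 by ring,
        Nat.choose_succ_succ m (2 * k + 1)]
      push_cast
      generalize (m.choose (2 * k + 1) : ℂ) = A
      generalize (m.choose (Nat.succ (2 * k + 1)) : ℂ) = E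
      generalize eval (ν + 1 + 1 / 2) (ascPochhammer ℂ k) = x at *
      generalize eval (1 / 2) (ascPochhammer ℂ k) = z at *
      obtain ⟨h, hh⟩ : ∃ h, h = ν + 1 / 2 := ⟨_, rfl⟩
      obtain ⟨g, hg⟩ : ∃ g, g = ν + 1 + 1 / 2 + (k : ℂ) := ⟨_, rfl⟩
      rw [← hg] at n2 ⊢
      rw [← hh] at n3 ⊢
      have e1 : 2 * ((k : ℂ) + 1) + 2 * ν + 1 = 2 * g := by rw [hg]; ring
      have e2 : 2 * ν + 1 = 2 * h := by rw [hh]; ring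
      rw [e1, e2, pow_succ]
      field_simp
      ring
    linear_combination u ^ (m - 2 * k - 1) * c ^ (k + 1) * key
  have hz : m + 1 - 2 * 0 = m + 1 := rfl
  simp only [Nat.cast_zero, hz, pow_zero] at h2 ⊢
  linear_combination h2

theorem hasDerivAt_ultraWeight_succ {ν : ℂ} (hν : 0 ≤ ν.re) {u : ℝ} (hu : u ∈ Set.Ioo (-1 : ℝ) 1) :
    HasDerivAt (ultraWeight (ν + 1)) (-(2 * ν + 1) * u * ultraWeight ν u) u := by
  have hc : 1 - u ^ 2 ≠ 0 := by nlinarith [hu.1, hu.2]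
  have hr : ν + 1 / 2 ≠ 0 := fun h => by
    have := re_add_half_pos hν
    rw [h] at this
    simp at this
  have h1 := hasDerivAt_ofReal_cpow_const hc hr
  have h2 : HasDerivAt (fun u : ℝ => 1 - u ^ 2) (-(2 * u)) u := by
    simpa using ((hasDerivAt_id u).pow 2).const_sub 1
  have h3 := HasDerivAt.scomp u h1 h2
  have e : ultraWeight (ν + 1) = (fun y : ℝ => (y : ℂ) ^ (ν + 1 / 2)) ∘ fun u : ℝ => 1 - u ^ 2 := by
    funext v
    simp only [ultraWeight, Function.comp]
    congr 1
    ring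
  rw [e]
  refine h3.congr_deriv ?_
  rw [ultraWeight, show ν + 1 / 2 - 1 = ν - 1 / 2 by ring, Complex.real_smul]
  push_cast
  ring

theorem ultraWeight_succ (ν : ℂ) {u : ℝ} (hu : u ∈ Set.Ioo (-1 : ℝ) 1) :
    ultraWeight (ν + 1) u = ((1 - u ^ 2 : ℝ) : ℂ) * ultraWeight ν u := by
  have hc : ((1 - u ^ 2 : ℝ) : ℂ) ≠ 0 := Complex.ofReal_ne_zero.2 (by nlinarith [hu.1, hu.2])
  rw [ultraWeight, ultraWeight, show ν + 1 - 1 / 2 = ν - 1 / 2 + 1 by ring, Complex.cpow_add _ _ hc,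
    Complex.cpow_one, mul_comm]

/-- The ultraspherical polynomial of complex type, as a function on the line. -/
def gegenbauerVal (ν : ℂ) (m : ℕ) (u : ℝ) : ℂ := gegenbauerForm ν m u ((1 - u ^ 2 : ℝ) : ℂ)

theorem continuous_gegenbauerVal (ν : ℂ) (m : ℕ) : Continuous (gegenbauerVal ν m) := by
  unfold gegenbauerVal gegenbauerForm
  fun_prop

/-- The ladder relation
`d/du ((1 - u²)^(ν + 1/2) P_m^{ν+1}) = -(2 ν + 1) (1 - u²)^(ν - 1/2) P_{m+1}^ν`. -/
theorem hasDerivAt_ladder {ν : ℂ} (hν : 0 ≤ ν.re) (m : ℕ) {u : ℝ} (hu : u ∈ Set.Ioo (-1 : ℝ) 1) :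
    HasDerivAt (fun u => ultraWeight (ν + 1) u * gegenbauerVal (ν + 1) m u)
      (-(2 * ν + 1) * (ultraWeight ν u * gegenbauerVal ν (m + 1) u)) u := by
  have hid : HasDerivAt (fun u : ℝ => (u : ℂ)) 1 u := Complex.ofRealCLM.hasDerivAt
  have h2 : HasDerivAt (fun u : ℝ => ((1 - u ^ 2 : ℝ) : ℂ)) (-2 * u) u := by
    have h := ((hasDerivAt_id u).pow 2).const_sub 1
    exact h.ofReal_comp.congr_deriv (by simp)
  have h3 : HasDerivAt (gegenbauerVal (ν + 1) m)
      (∑ k ∈ Finset.range (m + 1), gegenbauerCoeff (ν + 1) m k *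
        (((m - 2 * k : ℕ) : ℂ) * (u : ℂ) ^ (m - 2 * k - 1) * ((1 - u ^ 2 : ℝ) : ℂ) ^ k +
          (u : ℂ) ^ (m - 2 * k) * ((k : ℂ) * ((1 - u ^ 2 : ℝ) : ℂ) ^ (k - 1) * (-2 * u)))) u := by
    unfold gegenbauerVal gegenbauerForm
    refine HasDerivAt.fun_sum fun k _ => ?_
    have := ((hid.pow (m - 2 * k)).mul (h2.pow k)).const_mul (gegenbauerCoeff (ν + 1) m k)
    have e : (fun v : ℝ => gegenbauerCoeff (ν + 1) m k * (v : ℂ) ^ (m - 2 * k) *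
        ((1 - v ^ 2 : ℝ) : ℂ) ^ k) = fun v : ℝ => gegenbauerCoeff (ν + 1) m k *
          ((fun u : ℝ => (u : ℂ)) ^ (m - 2 * k) * (fun u : ℝ => ((1 - u ^ 2 : ℝ) : ℂ)) ^ k) v := by
      funext v
      simp [mul_assoc]
    rw [e]
    exact this.congr_deriv (by simp [mul_assoc])
  have h4 := (hasDerivAt_ultraWeight_succ hν hu).mul h3
  refine h4.congr_deriv ?_
  rw [ultraWeight_succ ν hu]
  have h5 := gegenbauerForm_ladder (re_add_half_pos hν) m u ((1 - u ^ 2 : ℝ) : ℂ)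
  rw [gegenbauerVal, gegenbauerVal]
  linear_combination ultraWeight ν u * h5

theorem continuous_ultraWeight_succ {ν : ℂ} (hν : 0 ≤ ν.re) : Continuous (ultraWeight (ν + 1)) := by
  have h := Complex.continuous_ofReal_cpow_const (y := ν + 1 - 1 / 2) (by
    have := re_add_half_pos hν
    rw [show ν + 1 - 1 / 2 = ν + 1 / 2 by ring]
    exact this)
  exact h.comp (by fun_prop : Continuous fun u : ℝ => 1 - u ^ 2)

/-- The moments `∫ u^n (1 - u²)^(ν - 1/2) P_m^ν(u) du` over `[-1, 1]`. -/
def gegenbauerMoment (m n : ℕ) (ν : ℂ) : ℂ :=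
  ∫ u in (-1 : ℝ)..1, ultraWeight ν u * gegenbauerVal ν m u * (u : ℂ) ^ n

theorem intervalIntegrable_moment {ν : ℂ} (hν : 0 ≤ ν.re) (m n : ℕ) :
    IntervalIntegrable (fun u : ℝ => ultraWeight ν u * gegenbauerVal ν m u * (u : ℂ) ^ n)
      volume (-1) 1 :=
  ((intervalIntegrable_ultraWeight hν).mul_continuousOn
    (continuous_gegenbauerVal ν m).continuousOn).mul_continuousOn
      (by fun_prop : Continuous fun u : ℝ => (u : ℂ) ^ n).continuousOn

theorem ultraWeight_succ_endpoint {ν : ℂ} (hν : 0 ≤ ν.re) {u : ℝ} (hu : u ^ 2 = 1) :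
    ultraWeight (ν + 1) u = 0 := by
  have hr : ν + 1 - 1 / 2 ≠ 0 := fun h => by
    have := re_add_half_pos hν
    rw [show ν + 1 / 2 = ν + 1 - 1 / 2 by ring, h] at this
    simp at this
  rw [ultraWeight, hu, sub_self, Complex.ofReal_zero, Complex.zero_cpow hr]

/-- Integration by parts lowers the degree and raises the type. -/
theorem gegenbauerMoment_succ {ν : ℂ} (hν : 0 ≤ ν.re) (m n : ℕ) :
    (2 * ν + 1) * gegenbauerMoment (m + 1) n ν =
      (n : ℂ) * gegenbauerMoment m (n - 1) (ν + 1) := by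
  have hν1 := re_add_one_nonneg hν
  have hi1 := (intervalIntegrable_moment hν (m + 1) n).const_mul (-(2 * ν + 1))
  have hi2 := (intervalIntegrable_moment hν1 m (n - 1)).const_mul (n : ℂ)
  have hd : ∀ u ∈ Set.Ioo (-1 : ℝ) 1,
      HasDerivAt (fun u : ℝ => ultraWeight (ν + 1) u * gegenbauerVal (ν + 1) m u * (u : ℂ) ^ n)
        (-(2 * ν + 1) * (ultraWeight ν u * gegenbauerVal ν (m + 1) u * (u : ℂ) ^ n) +
          (n : ℂ) * (ultraWeight (ν + 1) u * gegenbauerVal (ν + 1) m u * (u : ℂ) ^ (n - 1))) u := by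
    intro u hu
    have hid : HasDerivAt (fun u : ℝ => (u : ℂ)) 1 u := Complex.ofRealCLM.hasDerivAt
    refine ((hasDerivAt_ladder hν m hu).mul (hid.pow n)).congr_deriv ?_
    simp only [Pi.pow_apply]
    ring
  have hcont : Continuous
      (fun u : ℝ => ultraWeight (ν + 1) u * gegenbauerVal (ν + 1) m u * (u : ℂ) ^ n) :=
    ((continuous_ultraWeight_succ hν).mul (continuous_gegenbauerVal _ _)).mul (by fun_prop)
  have h := intervalIntegral.integral_eq_sub_of_hasDerivAt_of_le (by norm_num)
    hcont.continuousOn hd (hi1.add hi2)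
  rw [intervalIntegral.integral_add hi1 hi2, intervalIntegral.integral_const_mul,
    intervalIntegral.integral_const_mul] at h
  rw [ultraWeight_succ_endpoint hν (by norm_num), ultraWeight_succ_endpoint hν (by norm_num)] at h
  rw [gegenbauerMoment, gegenbauerMoment]
  linear_combination -h

theorem two_mul_add_one_ne_zero {ν : ℂ} (hν : 0 ≤ ν.re) : 2 * ν + 1 ≠ 0 := fun h => by
  have := re_add_half_pos hν
  rw [show ν + 1 / 2 = (2 * ν + 1) / 2 by ring, h] at this
  simp at this

/-- Orthogonality to the polynomials of lower degree. -/
theorem gegenbauerMoment_of_lt {m n : ℕ} (h : n < m) {ν : ℂ} (hν : 0 ≤ ν.re) :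
    gegenbauerMoment m n ν = 0 := by
  induction m generalizing n ν with
  | zero => omega
  | succ m ih =>
    refine (mul_eq_zero.1 ?_).resolve_left (two_mul_add_one_ne_zero hν)
    rw [gegenbauerMoment_succ hν]
    cases n with
    | zero => simp
    | succ n => rw [ih (by omega) (re_add_one_nonneg hν), mul_zero]

/-- As `P_1^ν(u) = u`, integration by parts applies to the moments of the weight as well. -/
theorem gegenbauerMoment_zero_succ (n : ℕ) (ν : ℂ) :
    gegenbauerMoment 0 (n + 1) ν = gegenbauerMoment 1 n ν := by
  rw [gegenbauerMoment, gegenbauerMoment]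
  congr 1
  funext u
  simp [gegenbauerVal, gegenbauerForm, gegenbauerCoeff, Finset.sum_range_succ]
  ring

theorem gegenbauerMoment_zero_odd (l : ℕ) {ν : ℂ} (hν : 0 ≤ ν.re) :
    gegenbauerMoment 0 (2 * l + 1) ν = 0 := by
  induction l generalizing ν with
  | zero => rw [gegenbauerMoment_zero_succ, gegenbauerMoment_of_lt (by omega) hν]
  | succ l ih =>
    refine (mul_eq_zero.1 ?_).resolve_left (two_mul_add_one_ne_zero hν)
    rw [show 2 * (l + 1) + 1 = (2 * l + 2) + 1 by ring, gegenbauerMoment_zero_succ,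
      gegenbauerMoment_succ hν, show 2 * l + 2 - 1 = 2 * l + 1 by omega,
      ih (re_add_one_nonneg hν), mul_zero]

theorem gegenbauerMoment_odd (m l : ℕ) {ν : ℂ} (hν : 0 ≤ ν.re) :
    gegenbauerMoment m (m + (2 * l + 1)) ν = 0 := by
  induction m generalizing ν with
  | zero => rw [zero_add, gegenbauerMoment_zero_odd l hν]
  | succ m ih =>
    refine (mul_eq_zero.1 ?_).resolve_left (two_mul_add_one_ne_zero hν)
    rw [gegenbauerMoment_succ hν, show m + 1 + (2 * l + 1) - 1 = m + (2 * l + 1) by omega,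
      ih (re_add_one_nonneg hν), mul_zero]

theorem Gamma_add_one_add_half {ν : ℂ} (hν : 0 ≤ ν.re) :
    2 * Complex.Gamma (ν + 1 + 1 / 2) = (2 * ν + 1) * Complex.Gamma (ν + 1 / 2) := by
  have h : ν + 1 / 2 ≠ 0 := fun h => by
    have := re_add_half_pos hν
    rw [h] at this
    simp at this
  rw [show ν + 1 + 1 / 2 = ν + 1 / 2 + 1 by ring, Complex.Gamma_add_one _ h]
  ring

theorem gegenbauerMoment_zero_even (l : ℕ) {ν : ℂ} (hν : 0 ≤ ν.re) :
    gegenbauerMoment 0 (2 * l) ν * (2 ^ (2 * l) * (l.factorial : ℂ) * Complex.Gamma (ν + l + 1)) =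
      ((2 * l).factorial : ℂ) * ((√Real.pi : ℂ) * Complex.Gamma (ν + 1 / 2)) := by
  induction l generalizing ν with
  | zero =>
    have := integral_ultraWeight hν
    simpa [gegenbauerMoment, gegenbauerVal, gegenbauerForm, gegenbauerCoeff] using this
  | succ l ih =>
    have h1 := ih (re_add_one_nonneg hν)
    have h2 := gegenbauerMoment_succ hν 0 (2 * l + 1)
    rw [show 2 * (l + 1) = 2 * l + 1 + 1 by ring, gegenbauerMoment_zero_succ]
    rw [Nat.add_sub_cancel] at h2
    refine mul_left_cancel₀ (two_mul_add_one_ne_zero hν) ?_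
    rw [Nat.factorial_succ l, Nat.factorial_succ (2 * l + 1), Nat.factorial_succ (2 * l),
      show ν + ((l + 1 : ℕ) : ℂ) + 1 = ν + 1 + l + 1 by push_cast; ring]
    have h3 := Gamma_add_one_add_half hν
    push_cast at h2 ⊢
    linear_combination (2 ^ (2 * l + 1 + 1) * (((l : ℂ) + 1) * (l.factorial : ℂ)) *
      Complex.Gamma (ν + 1 + l + 1)) * h2 + (2 * (l : ℂ) + 1) * 4 * (l + 1) * h1 +
      (2 * (l : ℂ) + 1) * 2 * (l + 1) * ((2 * l).factorial : ℂ) * (√Real.pi : ℂ) * h3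

theorem gegenbauerMoment_even (m l : ℕ) {ν : ℂ} (hν : 0 ≤ ν.re) :
    gegenbauerMoment m (m + 2 * l) ν *
        (2 ^ (m + 2 * l) * (l.factorial : ℂ) * Complex.Gamma (ν + m + l + 1)) =
      ((m + 2 * l).factorial : ℂ) * ((√Real.pi : ℂ) * Complex.Gamma (ν + 1 / 2)) := by
  induction m generalizing ν with
  | zero => simpa using gegenbauerMoment_zero_even l hν
  | succ m ih =>
    have h1 := ih (re_add_one_nonneg hν)
    have h2 := gegenbauerMoment_succ hν m (m + 2 * l + 1)
    rw [Nat.add_sub_cancel] at h2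
    refine mul_left_cancel₀ (two_mul_add_one_ne_zero hν) ?_
    rw [show m + 1 + 2 * l = m + 2 * l + 1 by ring, Nat.factorial_succ,
      show ν + ((m + 1 : ℕ) : ℂ) + l + 1 = ν + 1 + m + l + 1 by push_cast; ring]
    have h3 := Gamma_add_one_add_half hν
    push_cast at h2 ⊢
    linear_combination (2 ^ (m + 2 * l + 1) * (l.factorial : ℂ) *
      Complex.Gamma (ν + 1 + m + l + 1)) * h2 + ((m : ℂ) + 2 * l + 1) * 2 * h1 +
      ((m : ℂ) + 2 * l + 1) * ((m + 2 * l).factorial : ℂ) * (√Real.pi : ℂ) * h3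

theorem funQ_eq_ultraWeight {lam : ℂ} (hl : 0 ≤ lam.re) (m : ℕ) {u : ℝ}
    (hu : u ∈ Set.Ioo (-1 : ℝ) 1) :
    funQ m lam u = 1 / 2 * (Complex.Gamma (lam.re + 1 / 2) / Complex.Gamma (lam + 1 / 2)) *
      (ultraWeight lam u * gegenbauerVal lam m u) := by
  rw [funQ_eq hl m (abs_lt.2 hu), closedQ, ultraWeight, gegenbauerVal, mul_assoc]

theorem intervalIntegrable_funQ {lam : ℂ} (hl : 0 ≤ lam.re) (m : ℕ) :
    IntervalIntegrable (funQ m lam) volume (-1) 1 := by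
  refine IntervalIntegrable.congr_uIoo (((intervalIntegrable_ultraWeight hl).mul_continuousOn
    (continuous_gegenbauerVal lam m).continuousOn).const_mul
      (1 / 2 * (Complex.Gamma (lam.re + 1 / 2) / Complex.Gamma (lam + 1 / 2)))) fun u hu => ?_
  rw [Set.uIoo_of_le (by norm_num)] at hu
  exact (funQ_eq_ultraWeight hl m hu).symm

theorem integral_pow_mul_funQ {lam : ℂ} (hl : 0 ≤ lam.re) (m n : ℕ) :
    ∫ u in (-1 : ℝ)..1, (u : ℂ) ^ n * funQ m lam u =
      1 / 2 * (Complex.Gamma (lam.re + 1 / 2) / Complex.Gamma (lam + 1 / 2)) *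
        gegenbauerMoment m n lam := by
  rw [gegenbauerMoment, ← intervalIntegral.integral_const_mul]
  refine intervalIntegral.integral_congr_uIoo fun u hu => ?_
  rw [Set.uIoo_of_le (by norm_num)] at hu
  rw [funQ_eq_ultraWeight hl m hu]
  ring

theorem integral_pow_mul_funQ_of_lt {lam : ℂ} (hl : 0 ≤ lam.re) {m n : ℕ} (h : n < m) :
    ∫ u in (-1 : ℝ)..1, (u : ℂ) ^ n * funQ m lam u = 0 := by
  rw [integral_pow_mul_funQ hl, gegenbauerMoment_of_lt h hl, mul_zero]

theorem integral_pow_mul_funQ_odd {lam : ℂ} (hl : 0 ≤ lam.re) (m l : ℕ) :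
    ∫ u in (-1 : ℝ)..1, (u : ℂ) ^ (m + (2 * l + 1)) * funQ m lam u = 0 := by
  rw [integral_pow_mul_funQ hl, gegenbauerMoment_odd m l hl, mul_zero]

theorem integral_pow_mul_funQ_even {lam : ℂ} (hl : 0 ≤ lam.re) (m l : ℕ) :
    ∫ u in (-1 : ℝ)..1, (u : ℂ) ^ (m + 2 * l) * funQ m lam u =
      (√Real.pi : ℂ) * Complex.Gamma (lam.re + 1 / 2) / 2 * (((m + 2 * l).factorial : ℂ) /
        (2 ^ (m + 2 * l) * ((l.factorial : ℂ) * Complex.Gamma (l + (lam + m) + 1)))) := by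
  have h := gegenbauerMoment_even m l hl
  have n1 : Complex.Gamma (lam + 1 / 2) ≠ 0 :=
    Complex.Gamma_ne_zero_of_re_pos (re_add_half_pos hl)
  have n2 : Complex.Gamma (l + (lam + m) + 1) ≠ 0 := Complex.Gamma_ne_zero_of_re_pos (by
    have h1 : (0 : ℝ) ≤ l := l.cast_nonneg
    have h2 : (0 : ℝ) ≤ m := m.cast_nonneg
    simp
    linarith)
  have n3 : (l.factorial : ℂ) ≠ 0 := Nat.cast_ne_zero.2 l.factorial_ne_zero
  rw [show lam + m + l + 1 = l + (lam + m) + 1 by ring] at h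
  rw [integral_pow_mul_funQ hl]
  generalize gegenbauerMoment m (m + 2 * l) lam = J at *
  generalize Complex.Gamma (l + (lam + m) + 1) = G at *
  generalize Complex.Gamma (lam + 1 / 2) = H at *
  generalize Complex.Gamma (lam.re + 1 / 2) = K at *
  generalize ((m + 2 * l).factorial : ℂ) = F at *
  have n4 : (2 : ℂ) ^ (m + 2 * l) ≠ 0 := pow_ne_zero _ two_ne_zero
  generalize (2 : ℂ) ^ (m + 2 * l) = T at *
  field_simp
  linear_combination K * h

/-! ### Generating series of the kernels -/

theorem cesaroNumber_eq {δ : ℂ} (hδ : 0 < (δ + 1).re) (j : ℕ) :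
    cesaroNumber δ j = risingCoeff (δ + 1) j := by
  rw [cesaroNumber, risingCoeff, Complex.Gamma_nat_eq_factorial,
    show (j : ℂ) + δ + 1 = δ + 1 + j by ring, Gamma_add_nat hδ]
  have := Complex.Gamma_ne_zero_of_re_pos hδ
  field_simp

theorem cesaroNumber_ne_zero {δ : ℂ} (hδ : 0 < (δ + 1).re) (j : ℕ) : cesaroNumber δ j ≠ 0 := by
  rw [cesaroNumber_eq hδ, risingCoeff]
  exact div_ne_zero (ascPochhammer_eval_ne_zero hδ j) (Nat.cast_ne_zero.2 j.factorial_ne_zero)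

theorem laguerrePoly_eq {α : ℂ} (hα : -1 < α.re) (n : ℕ) (x : ℝ) :
    laguerrePoly α n x = (lagPoly α n).eval (x : ℂ) := by
  rw [eval_lagPoly, coeff_laguerreSeries, laguerrePoly]
  refine Finset.sum_congr rfl fun j hj => ?_
  have hj' : j ≤ n := Nat.lt_succ_iff.1 (Finset.mem_range.1 hj)
  have hre : 0 < (α + j + 1).re := by
    have : (0 : ℝ) ≤ j := j.cast_nonneg
    simp
    linarith
  have h1 : (n : ℂ) + α + 1 = (α + j + 1) + ((n - j : ℕ) : ℂ) := by
    rw [Nat.cast_sub hj']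
    ring
  have h2 := Complex.Gamma_ne_zero_of_re_pos hre
  rw [h1, Gamma_add_nat hre, show (j : ℂ) + α + 1 = α + j + 1 by ring, risingCoeff]
  field_simp

/-- In the product of two Laguerre functions the complex square roots combine, whatever the
branch. -/
theorem laguerreFun_mul {α : ℂ} (hα : -1 < α.re) (n : ℕ) (r s : ℝ) :
    laguerreFun α n r * laguerreFun α n s =
      2 * (Real.exp (-(r ^ 2 + s ^ 2) / 2) : ℂ) *
        ((n.factorial : ℂ) / Complex.Gamma (n + α + 1) *
          ((lagPoly α n).eval ((r : ℂ) ^ 2) * (lagPoly α n).eval ((s : ℂ) ^ 2))) := by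
  have h : ∀ z : ℂ, z ^ (1 / 2 : ℂ) * z ^ (1 / 2 : ℂ) = z := fun z => by
    have := Complex.cpow_nat_inv_pow z two_ne_zero
    rw [pow_two] at this
    rw [one_div]
    exact_mod_cast this
  have he : (Real.exp (-(r ^ 2 + s ^ 2) / 2) : ℂ) =
      (Real.exp (-r ^ 2 / 2) : ℂ) * (Real.exp (-s ^ 2 / 2) : ℂ) := by
    rw [← Complex.ofReal_mul, ← Real.exp_add]
    congr 2
    ring
  rw [laguerreFun, laguerreFun, laguerrePoly_eq hα, laguerrePoly_eq hα, he,
    Complex.Gamma_nat_eq_factorial, Complex.ofReal_pow, Complex.ofReal_pow]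
  linear_combination (Polynomial.eval ((r : ℂ) ^ 2) (lagPoly α n) * (Real.exp (-r ^ 2 / 2) : ℂ) *
    (Polynomial.eval ((s : ℂ) ^ 2) (lagPoly α n) * (Real.exp (-s ^ 2 / 2) : ℂ))) *
      h (2 * (n.factorial : ℂ) / Complex.Gamma (n + α + 1))

/-- The Cauchy product with a series in `X²`. -/
theorem coeff_expand_two_mul (F G : PowerSeries ℂ) (n : ℕ) :
    PowerSeries.coeff n (PowerSeries.expand 2 two_ne_zero F * G) =
      ∑ j ∈ Finset.range (n / 2 + 1),
        PowerSeries.coeff j F * PowerSeries.coeff (n - 2 * j) G := by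
  rw [PowerSeries.coeff_mul, Finset.Nat.sum_antidiagonal_eq_sum_range_succ_mk]
  symm
  refine Finset.sum_of_injOn (fun j => 2 * j) (fun a _ b _ h => by simpa using h) ?_ ?_ ?_
  · intro j hj
    simp only [Finset.coe_range, Set.mem_Iio] at hj ⊢
    omega
  · intro i hi hi'
    rw [PowerSeries.coeff_expand_of_not_dvd, zero_mul]
    rintro ⟨j, rfl⟩
    refine hi' ⟨j, ?_, rfl⟩
    simp only [Finset.coe_range, Set.mem_Iio, Finset.mem_range] at hi ⊢
    omega
  · intro j _
    rw [PowerSeries.coeff_expand_mul]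

theorem coeff_mul_congr {F G H : PowerSeries ℂ} {n : ℕ}
    (h : ∀ i ≤ n, PowerSeries.coeff i G = PowerSeries.coeff i H) :
    PowerSeries.coeff n (F * G) = PowerSeries.coeff n (F * H) := by
  rw [PowerSeries.coeff_mul, PowerSeries.coeff_mul]
  refine Finset.sum_congr rfl fun p hp => ?_
  rw [h p.2 (by have := Finset.HasAntidiagonal.mem_antidiagonal.1 hp; omega)]

theorem coeff_mul_eq_sum_range (F G : PowerSeries ℂ) (n : ℕ) :
    PowerSeries.coeff n (F * G) =
      ∑ i ∈ Finset.range (n + 1), PowerSeries.coeff (n - i) F * PowerSeries.coeff i G := by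
  rw [mul_comm, PowerSeries.coeff_mul, Finset.Nat.sum_antidiagonal_eq_sum_range_succ_mk]
  exact Finset.sum_congr rfl fun i _ => mul_comm _ _

theorem sum_range_two_mul (f : ℕ → ℂ) (n : ℕ) :
    ∑ j ∈ Finset.range (2 * n), f j = ∑ l ∈ Finset.range n, (f (2 * l) + f (2 * l + 1)) := by
  induction n with
  | zero => simp
  | succ n ih =>
    rw [show 2 * (n + 1) = 2 * n + 1 + 1 by ring, Finset.sum_range_succ, Finset.sum_range_succ, ih,
      Finset.sum_range_succ]
    ring

theorem projCoeff_eq_zero (D : ℕ) {i k : ℕ} (h : i < k) (r s : ℝ) : projCoeff D i k r s = 0 := by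
  rw [projCoeff, PowerSeries.coeff_X_pow_mul', if_neg (by omega), mul_zero, mul_zero]

/-- The integral of the `i`-th Hermite projection kernel against `Q_m^λ`. -/
def projIntegral (D m : ℕ) (lam : ℂ) (r s : ℝ) (i : ℕ) : ℂ :=
  ∑ k ∈ Finset.range (i + 1),
    projCoeff D i k r s * ∫ u in (-1 : ℝ)..1, (u : ℂ) ^ k * funQ m lam u

theorem projIntegral_eq (D m : ℕ) (lam : ℂ) (r s : ℝ) {i M : ℕ} (hM : i < M) :
    projIntegral D m lam r s i = ∑ k ∈ Finset.range M,
      projCoeff D i k r s * ∫ u in (-1 : ℝ)..1, (u : ℂ) ^ k * funQ m lam u := by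
  refine Finset.sum_subset (Finset.range_mono hM) fun k _ hk => ?_
  rw [Finset.mem_range] at hk
  rw [projCoeff_eq_zero D (by omega), zero_mul]

theorem intervalIntegrable_finsetSum {ι : Type*} {t : Finset ι} {f : ι → ℝ → ℂ} {a b : ℝ}
    (h : ∀ i ∈ t, IntervalIntegrable (f i) volume a b) :
    IntervalIntegrable (fun u => ∑ i ∈ t, f i u) volume a b := by
  have := IntervalIntegrable.sum t h
  rwa [Finset.sum_fn] at this

theorem intervalIntegrable_pow_mul_funQ {lam : ℂ} (hl : 0 ≤ lam.re) (m k : ℕ) :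
    IntervalIntegrable (fun u : ℝ => (u : ℂ) ^ k * funQ m lam u) volume (-1) 1 :=
  (intervalIntegrable_funQ hl m).continuousOn_mul
    (by fun_prop : Continuous fun u : ℝ => (u : ℂ) ^ k).continuousOn

theorem radialCesaroKernel_mul_funQ {D : ℕ} (hD : 2 ≤ D) (δ : ℂ) (m n : ℕ) (lam : ℂ) (r s : ℝ)
    {u : ℝ} (hu : u ∈ Set.Icc (-1 : ℝ) 1) :
    radialCesaroKernel D δ n r s u * funQ m lam u = 1 / cesaroNumber δ n *
      ∑ i ∈ Finset.range (n + 1), cesaroNumber δ (n - i) *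
        ∑ k ∈ Finset.range (n + 1), projCoeff D i k r s * ((u : ℂ) ^ k * funQ m lam u) := by
  rw [radialCesaroKernel_eq hD δ n r s hu, mul_assoc, Finset.sum_mul]
  congr 1
  refine Finset.sum_congr rfl fun i _ => ?_
  rw [mul_assoc, Finset.sum_mul]
  congr 1
  exact Finset.sum_congr rfl fun k _ => mul_assoc _ _ _

theorem intervalIntegrable_radialCesaroKernel_mul_funQ {D : ℕ} (hD : 2 ≤ D) (δ : ℂ) (m n : ℕ)
    {lam : ℂ} (hl : 0 ≤ lam.re) (r s : ℝ) :
    IntervalIntegrable (fun u => radialCesaroKernel D δ n r s u * funQ m lam u) volume (-1) 1 := by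
  have h : IntervalIntegrable (fun u : ℝ => 1 / cesaroNumber δ n *
      ∑ i ∈ Finset.range (n + 1), cesaroNumber δ (n - i) *
        ∑ k ∈ Finset.range (n + 1), projCoeff D i k r s * ((u : ℂ) ^ k * funQ m lam u))
      volume (-1) 1 := by
    refine IntervalIntegrable.const_mul ?_ _
    refine intervalIntegrable_finsetSum fun i _ => IntervalIntegrable.const_mul ?_ _
    exact intervalIntegrable_finsetSum fun k _ =>
      (intervalIntegrable_pow_mul_funQ hl m k).const_mul _
  refine h.congr_uIoo fun u hu => ?_
  rw [Set.uIoo_of_le (by norm_num)] at hu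
  exact (radialCesaroKernel_mul_funQ hD δ m n lam r s ⟨hu.1.le, hu.2.le⟩).symm

/-- Multiplication by `A_n^δ` cancels the normalization of the Cesàro kernel, so these integrals
have the generating series `(1 - X)^(-δ - 1) ∑ X^i ∫ Φ_i Q_m^λ`. -/
theorem integral_radialCesaroKernel_mul_funQ {D : ℕ} (hD : 2 ≤ D) {δ : ℂ} (hδ : 0 < (δ + 1).re)
    (m n : ℕ) {lam : ℂ} (hl : 0 ≤ lam.re) (r s : ℝ) :
    cesaroNumber δ n * ∫ u in (-1 : ℝ)..1, radialCesaroKernel D δ n r s u * funQ m lam u =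
      PowerSeries.coeff n (negPow (δ + 1) * PowerSeries.mk (projIntegral D m lam r s)) := by
  have hint := intervalIntegrable_pow_mul_funQ hl m
  rw [intervalIntegral.integral_congr (g := fun u : ℝ => 1 / cesaroNumber δ n *
      ∑ i ∈ Finset.range (n + 1), cesaroNumber δ (n - i) *
        ∑ k ∈ Finset.range (n + 1), projCoeff D i k r s * ((u : ℂ) ^ k * funQ m lam u))
      (fun u hu => radialCesaroKernel_mul_funQ hD δ m n lam r s
        (by rwa [Set.uIcc_of_le (by norm_num)] at hu)),
    intervalIntegral.integral_const_mul, ← mul_assoc,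
    mul_one_div_cancel (cesaroNumber_ne_zero hδ n), one_mul, intervalIntegral.integral_finsetSum,
    coeff_mul_eq_sum_range]
  · refine Finset.sum_congr rfl fun i hi => ?_
    rw [intervalIntegral.integral_const_mul, intervalIntegral.integral_finsetSum, coeff_negPow,
      cesaroNumber_eq hδ, PowerSeries.coeff_mk, projIntegral_eq _ _ _ _ _ (Finset.mem_range.1 hi)]
    · congr 1
      exact Finset.sum_congr rfl fun k _ => intervalIntegral.integral_const_mul _ _
    · exact fun k _ => (hint k).const_mul _
  · exact fun i _ => IntervalIntegrable.const_mul
      (intervalIntegrable_finsetSum fun k _ => (hint k).const_mul _) _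

/-- The constant common to all the integrals of Hermite projection kernels against `Q_m^λ`. -/
def projConst (D : ℕ) (lam : ℂ) (r s : ℝ) : ℂ :=
  ((Real.exp (-(r ^ 2 + s ^ 2) / 2) / √Real.pi ^ D : ℝ) : ℂ) *
    ((√Real.pi : ℂ) * Complex.Gamma (lam.re + 1 / 2) / 2)

/-- Only the powers `u^(m + 2 l)` contribute to the integrals of the projection kernels against
`Q_m^λ`. -/
theorem projIntegral_eq_coeff (D m : ℕ) {lam : ℂ} (hl : 0 ≤ lam.re) (r s : ℝ) {i M : ℕ}
    (hM : i ≤ M) :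
    projIntegral D m lam r s i = PowerSeries.coeff i
      (PowerSeries.C (projConst D lam r s * (r * s : ℂ) ^ m) * (PowerSeries.X ^ m *
        ∑ l ∈ Finset.range (M + 1),
          PowerSeries.C (((r : ℂ) ^ 2 * (s : ℂ) ^ 2) ^ l /
            ((l.factorial : ℂ) * Complex.Gamma (l + (lam + m) + 1))) *
          PowerSeries.expand 2 two_ne_zero (PowerSeries.X ^ l *
            laguerreSeries ((D : ℂ) / 2 - 1 + m + 2 * l) ((r : ℂ) ^ 2 + (s : ℂ) ^ 2)))) := by
  rw [projIntegral_eq D m lam r s (show i < m + 2 * (M + 1) by omega), Finset.sum_range_add,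
    Finset.sum_eq_zero (s := Finset.range m), zero_add, sum_range_two_mul, Finset.mul_sum,
    Finset.mul_sum, map_sum]
  · refine Finset.sum_congr rfl fun l _ => ?_
    rw [integral_pow_mul_funQ_odd hl, mul_zero, add_zero, integral_pow_mul_funQ_even hl, projCoeff,
      projConst]
    have e1 : PowerSeries.C (((Real.exp (-(r ^ 2 + s ^ 2) / 2) / √Real.pi ^ D : ℝ) : ℂ) *
        ((√Real.pi : ℂ) * Complex.Gamma (lam.re + 1 / 2) / 2) * (r * s : ℂ) ^ m) *
        (PowerSeries.X ^ m * (PowerSeries.C (((r : ℂ) ^ 2 * (s : ℂ) ^ 2) ^ l /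
            ((l.factorial : ℂ) * Complex.Gamma (l + (lam + m) + 1))) *
          PowerSeries.expand 2 two_ne_zero (PowerSeries.X ^ l *
            laguerreSeries ((D : ℂ) / 2 - 1 + m + 2 * l) ((r : ℂ) ^ 2 + (s : ℂ) ^ 2)))) =
        PowerSeries.C (((Real.exp (-(r ^ 2 + s ^ 2) / 2) / √Real.pi ^ D : ℝ) : ℂ) *
          ((√Real.pi : ℂ) * Complex.Gamma (lam.re + 1 / 2) / 2) * (r * s : ℂ) ^ m *
          (((r : ℂ) ^ 2 * (s : ℂ) ^ 2) ^ l /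
            ((l.factorial : ℂ) * Complex.Gamma (l + (lam + m) + 1)))) *
        (PowerSeries.X ^ (m + 2 * l) * PowerSeries.expand 2 two_ne_zero
          (laguerreSeries ((D : ℂ) / 2 - 1 + m + 2 * l) ((r : ℂ) ^ 2 + (s : ℂ) ^ 2))) := by
      rw [map_mul (PowerSeries.expand 2 two_ne_zero), map_pow (PowerSeries.expand 2 two_ne_zero),
        PowerSeries.expand_X, pow_add, pow_mul, map_mul PowerSeries.C _ (_ / _)]
      ring
    have e2 : (D : ℂ) / 2 - 1 + ((m + 2 * l : ℕ) : ℂ) = (D : ℂ) / 2 - 1 + m + 2 * l := by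
      push_cast
      ring
    have e3 : ((r ^ 2 + s ^ 2 : ℝ) : ℂ) = (r : ℂ) ^ 2 + (s : ℂ) ^ 2 := by push_cast; rfl
    rw [e1, PowerSeries.coeff_C_mul, e2, e3]
    generalize PowerSeries.coeff i (PowerSeries.X ^ (m + 2 * l) * PowerSeries.expand 2 two_ne_zero
          (laguerreSeries ((D : ℂ) / 2 - 1 + m + 2 * l) ((r : ℂ) ^ 2 + (s : ℂ) ^ 2))) = x
    have n1 : ((m + 2 * l).factorial : ℂ) ≠ 0 := Nat.cast_ne_zero.2 (Nat.factorial_ne_zero _)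
    have n2 : (2 : ℂ) ^ (m + 2 * l) ≠ 0 := pow_ne_zero _ two_ne_zero
    rw [mul_pow (2 : ℂ), pow_add ((r : ℂ) * s), pow_mul ((r : ℂ) * s), mul_pow (r : ℂ) (s : ℂ) 2]
    generalize Complex.Gamma (l + (lam + m) + 1) = G
    generalize Complex.Gamma (lam.re + 1 / 2) = K
    generalize ((m + 2 * l).factorial : ℂ) = F at *
    generalize (2 : ℂ) ^ (m + 2 * l) = T at *
    field_simp
  · intro k hk
    rw [integral_pow_mul_funQ_of_lt hl (Finset.mem_range.1 hk), mul_zero]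

/-- The constant `C_D` is the one that turns the common factor of the integrals into the
normalization `2 e^(-(r² + s²) / 2)` of the products of Laguerre functions. -/
theorem constC_mul_projConst {D : ℕ} (hD : 2 ≤ D) {lam : ℂ} (hl : lam.re = (D : ℝ) / 2 - 1)
    (r s : ℝ) :
    (constC D : ℂ) * projConst D lam r s = 2 * (Real.exp (-(r ^ 2 + s ^ 2) / 2) : ℂ) := by
  have h2 : (2 : ℝ) ≤ D := by exact_mod_cast hD
  have hG : 0 < Real.Gamma (((D : ℝ) - 1) / 2) := Real.Gamma_pos_of_pos (by linarith)
  have hpi : 0 < √Real.pi := Real.sqrt_pos.2 Real.pi_pos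
  have e1 : Complex.Gamma (lam.re + 1 / 2) = (Real.Gamma (((D : ℝ) - 1) / 2) : ℂ) := by
    rw [← Complex.Gamma_ofReal, hl]
    congr 1
    push_cast
    ring
  have e2 : Real.pi ^ (((D : ℝ) - 1) / 2) * √Real.pi = √Real.pi ^ D := by
    rw [Real.sqrt_eq_rpow, ← Real.rpow_natCast, ← Real.rpow_mul Real.pi_pos.le,
      ← Real.rpow_add Real.pi_pos]
    congr 1
    ring
  rw [projConst, e1]
  have : constC D * (Real.exp (-(r ^ 2 + s ^ 2) / 2) / √Real.pi ^ D *
      (√Real.pi * Real.Gamma (((D : ℝ) - 1) / 2) / 2)) =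
        2 * Real.exp (-(r ^ 2 + s ^ 2) / 2) := by
    rw [constC, ← e2]
    have := Real.rpow_pos_of_pos Real.pi_pos (((D : ℝ) - 1) / 2)
    field_simp
    norm_num
  exact_mod_cast this

/-- The Hille–Hardy side of the argument: integrating the Mehler series against `Q_m^λ` and
multiplying by `(1 - X²)^(-b)` gives the series of products of Laguerre functions of type
`λ + m`. -/
theorem expand_negPow_mul_projIntegral {D : ℕ} (hD : 2 ≤ D) (m : ℕ) {lam b : ℂ}
    (hl : lam.re = (D : ℝ) / 2 - 1) (hb : lam = (D : ℂ) / 2 - 1 + b) (r s : ℝ) :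
    PowerSeries.C (constC D : ℂ) * (PowerSeries.expand 2 two_ne_zero (negPow b) *
        PowerSeries.mk (projIntegral D m lam r s)) =
      PowerSeries.X ^ m * PowerSeries.expand 2 two_ne_zero
        (PowerSeries.mk fun q => ((r * s : ℝ) : ℂ) ^ m *
          (laguerreFun (lam + m) q r * laguerreFun (lam + m) q s)) := by
  have h2 : (2 : ℝ) ≤ D := by exact_mod_cast hD
  have hl0 : 0 ≤ lam.re := by rw [hl]; linarith
  have hα : -1 < (lam + m).re := by
    have : (0 : ℝ) ≤ m := m.cast_nonneg
    simp
    linarith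
  ext N
  set g : ℕ → ℂ := fun l => ((r : ℂ) ^ 2 * (s : ℂ) ^ 2) ^ l /
    ((l.factorial : ℂ) * Complex.Gamma (l + (lam + m) + 1)) with hg
  have e0 : ∀ i ≤ N, PowerSeries.coeff i (PowerSeries.mk (projIntegral D m lam r s)) =
      PowerSeries.coeff i
        (PowerSeries.C (projConst D lam r s * (r * s : ℂ) ^ m) * (PowerSeries.X ^ m *
          ∑ l ∈ Finset.range (N + 1), PowerSeries.C (g l) *
            PowerSeries.expand 2 two_ne_zero (PowerSeries.X ^ l *
              laguerreSeries ((D : ℂ) / 2 - 1 + m + 2 * l) ((r : ℂ) ^ 2 + (s : ℂ) ^ 2)))) :=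
    fun i hi => by
      rw [PowerSeries.coeff_mk]
      exact projIntegral_eq_coeff D m hl0 r s hi
  have e1 : PowerSeries.expand 2 two_ne_zero (negPow b) *
      (PowerSeries.C (projConst D lam r s * (r * s : ℂ) ^ m) * (PowerSeries.X ^ m *
        ∑ l ∈ Finset.range (N + 1), PowerSeries.C (g l) *
          PowerSeries.expand 2 two_ne_zero (PowerSeries.X ^ l *
            laguerreSeries ((D : ℂ) / 2 - 1 + m + 2 * l) ((r : ℂ) ^ 2 + (s : ℂ) ^ 2)))) =
      PowerSeries.C (projConst D lam r s * (r * s : ℂ) ^ m) * (PowerSeries.X ^ m *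
        PowerSeries.expand 2 two_ne_zero (∑ l ∈ Finset.range (N + 1), PowerSeries.C (g l) *
          (PowerSeries.X ^ l *
            laguerreSeries (lam + m + 2 * l) ((r : ℂ) ^ 2 + (s : ℂ) ^ 2)))) := by
    rw [map_sum]
    have : ∀ l : ℕ, laguerreSeries (lam + m + 2 * l) ((r : ℂ) ^ 2 + (s : ℂ) ^ 2) = negPow b *
        laguerreSeries ((D : ℂ) / 2 - 1 + m + 2 * l) ((r : ℂ) ^ 2 + (s : ℂ) ^ 2) := fun l => by
      rw [negPow_mul_laguerreSeries, hb]
      congr 1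
      ring
    simp only [this, map_mul, PowerSeries.expand_C]
    simp only [Finset.mul_sum]
    refine Finset.sum_congr rfl fun l _ => ?_
    ring
  rw [PowerSeries.coeff_C_mul, coeff_mul_congr e0, e1, PowerSeries.coeff_C_mul,
    PowerSeries.coeff_X_pow_mul', PowerSeries.coeff_X_pow_mul']
  by_cases hmN : m ≤ N
  · rw [if_pos hmN, if_pos hmN, PowerSeries.coeff_expand, PowerSeries.coeff_expand]
    by_cases hdvd : 2 ∣ N - m
    · rw [if_pos hdvd, if_pos hdvd, PowerSeries.coeff_mk, map_sum, laguerreFun_mul hα,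
        laguerre_product hα]
      have e2 : ∑ l ∈ Finset.range (N + 1), PowerSeries.coeff ((N - m) / 2)
            (PowerSeries.C (g l) * (PowerSeries.X ^ l *
              laguerreSeries (lam + m + 2 * l) ((r : ℂ) ^ 2 + (s : ℂ) ^ 2))) =
          ∑ l ∈ Finset.range ((N - m) / 2 + 1), g l *
            (lagPoly (lam + m + 2 * l) ((N - m) / 2 - l)).eval ((r : ℂ) ^ 2 + (s : ℂ) ^ 2) := by
        rw [← Finset.sum_subset (Finset.range_mono (by omega :
          (N - m) / 2 + 1 ≤ N + 1))]
        · refine Finset.sum_congr rfl fun l hl => ?_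
          rw [PowerSeries.coeff_C_mul, PowerSeries.coeff_X_pow_mul',
            if_pos (Nat.lt_succ_iff.1 (Finset.mem_range.1 hl)), eval_lagPoly]
        · intro l _ hl
          rw [Finset.mem_range] at hl
          rw [PowerSeries.coeff_C_mul, PowerSeries.coeff_X_pow_mul', if_neg (by omega), mul_zero]
      rw [e2, ← mul_assoc, ← mul_assoc, constC_mul_projConst hD hl]
      push_cast
      ring
    · rw [if_neg hdvd, if_neg hdvd, mul_zero, mul_zero]
  · rw [if_neg hmN, if_neg hmN, mul_zero, mul_zero]

/-- The kernel formula for the dimension `D`, with the factors depending on `p` removed. -/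
theorem kernel_formula {D : ℕ} (hD : 2 ≤ D) (N m : ℕ) {lam b δ e : ℂ}
    (hl : lam.re = (D : ℝ) / 2 - 1) (hb : lam = (D : ℂ) / 2 - 1 + b) (he : 0 < (e + b).re)
    (hδ : 0 < (δ + e + 1).re) (hδ' : 0 < (δ + 2 * e + 1).re) (r s : ℝ) :
    (if m ≤ N then ∑ j ∈ Finset.range ((N - m) / 2 + 1),
        cesaroNumber (δ + 2 * e) (N - m - 2 * j) * ((r * s : ℝ) : ℂ) ^ m *
          laguerreFun (lam + m) j r * laguerreFun (lam + m) j s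
      else 0) =
      (constC D : ℂ) * ∑ k ∈ Finset.range (N + 1), Ring.choose e (N - k) *
        ∑ j ∈ Finset.range (k / 2 + 1), cesaroNumber (e + b - 1) j *
          (cesaroNumber (δ + e) (k - 2 * j) *
            ∫ u in (-1 : ℝ)..1,
              radialCesaroKernel D (δ + e) (k - 2 * j) r s u * funQ m lam u) := by
  have h2 : (2 : ℝ) ≤ D := by exact_mod_cast hD
  have hl0 : 0 ≤ lam.re := by rw [hl]; linarith
  have hR : (constC D : ℂ) * ∑ k ∈ Finset.range (N + 1), Ring.choose e (N - k) *
        ∑ j ∈ Finset.range (k / 2 + 1), cesaroNumber (e + b - 1) j *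
          (cesaroNumber (δ + e) (k - 2 * j) *
            ∫ u in (-1 : ℝ)..1,
              radialCesaroKernel D (δ + e) (k - 2 * j) r s u * funQ m lam u) =
      PowerSeries.coeff N (PowerSeries.C (constC D : ℂ) * (PowerSeries.binomialSeries ℂ e *
        (PowerSeries.expand 2 two_ne_zero (negPow (e + b)) * (negPow (δ + e + 1) *
          PowerSeries.mk (projIntegral D m lam r s))))) := by
    rw [PowerSeries.coeff_C_mul, coeff_mul_eq_sum_range]
    congr 1
    refine Finset.sum_congr rfl fun k _ => ?_
    rw [PowerSeries.binomialSeries_coeff, smul_eq_mul, mul_one, coeff_expand_two_mul]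
    congr 1
    refine Finset.sum_congr rfl fun j _ => ?_
    rw [integral_radialCesaroKernel_mul_funQ hD hδ m _ hl0, coeff_negPow,
      cesaroNumber_eq (by rw [sub_add_cancel]; exact he), sub_add_cancel]
  have hS := binomialSeries_mul_negPow e b (δ + 1)
  have hK := expand_negPow_mul_projIntegral hD m hl hb r s
  rw [show δ + 1 + e = δ + e + 1 by ring, show δ + 1 + 2 * e = δ + 2 * e + 1 by ring] at hS
  have hT : PowerSeries.C (constC D : ℂ) * (PowerSeries.binomialSeries ℂ e *
        (PowerSeries.expand 2 two_ne_zero (negPow (e + b)) * (negPow (δ + e + 1) *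
          PowerSeries.mk (projIntegral D m lam r s)))) =
      PowerSeries.X ^ m * (PowerSeries.expand 2 two_ne_zero
        (PowerSeries.mk fun q => ((r * s : ℝ) : ℂ) ^ m *
          (laguerreFun (lam + m) q r * laguerreFun (lam + m) q s)) * negPow (δ + 2 * e + 1)) := by
    linear_combination PowerSeries.C (constC D : ℂ) * PowerSeries.mk (projIntegral D m lam r s) * hS
      + negPow (δ + 2 * e + 1) * hK
  rw [hR, hT, PowerSeries.coeff_X_pow_mul']
  by_cases hmN : m ≤ N
  · rw [if_pos hmN, if_pos hmN, coeff_expand_two_mul]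
    refine Finset.sum_congr rfl fun j _ => ?_
    rw [PowerSeries.coeff_mk, coeff_negPow, cesaroNumber_eq hδ']
    ring
  · rw [if_neg hmN, if_neg hmN]

/-- The formula for the weighted kernel, for every `ζ` such that `λ(ζ) = D / 2 - 1 + b` and `b` is
purely imaginary. -/
theorem weightedKernel_eq {d D : ℕ} (hD : 2 ≤ D) (p p' : ℝ) {ε : ℝ} (hε : 0 < ε) (N m : ℕ)
    {ζ b : ℂ} (hb : b.re = 0) (hζ : (d : ℂ) + 2 * ζ = D + 2 * b) (r s : ℝ) :
    weightedKernel d p p' ε N m ζ r s =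
      (constC D : ℂ) / cesaroNumber (deltaParam d (ζ + ε)) N *
        ∑ k ∈ Finset.range (N + 1), Ring.choose ((ε : ℂ) / 2) (N - k) *
          ∑ j ∈ Finset.range (k / 2 + 1),
            cesaroNumber ((ε : ℂ) / 2 + b - 1) j *
            cesaroNumber (deltaParam d (ζ + ε / 2)) (k - 2 * j) *
            (r : ℂ) ^ (2 * deltaParam d ζ / (p : ℂ)) *
            (s : ℂ) ^ (2 * deltaParam d ζ / (p' : ℂ)) *
            ∫ u in (-1 : ℝ)..1,
              radialCesaroKernel D (deltaParam d (ζ + ε / 2)) (k - 2 * j) r s u *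
              funQ m (lambdaParam d ζ) u := by
  have h2 : (2 : ℝ) ≤ D := by exact_mod_cast hD
  have hlam : lambdaParam d ζ = (D : ℂ) / 2 - 1 + b := by
    rw [lambdaParam]
    linear_combination hζ / 2
  have hre : (lambdaParam d ζ).re = (D : ℝ) / 2 - 1 := by
    rw [hlam]
    simp [hb]
  have hδre : (deltaParam d ζ).re = ((D : ℝ) - 1) / 2 := by
    have : deltaParam d ζ = ((((D : ℝ) - 1) / 2 : ℝ) : ℂ) + b := by
      rw [deltaParam]
      push_cast
      linear_combination hζ / 2
    rw [this, Complex.add_re, Complex.ofReal_re, hb, add_zero]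
  have e1 : deltaParam d (ζ + ε / 2) = deltaParam d ζ + ε / 2 := by
    rw [deltaParam, deltaParam]; ring
  have e2 : deltaParam d (ζ + ε) = deltaParam d ζ + 2 * (ε / 2) := by
    rw [deltaParam, deltaParam]; ring
  have hεre : ((ε : ℂ) / 2).re = ε / 2 := by
    rw [show (ε : ℂ) / 2 = ((ε / 2 : ℝ) : ℂ) by push_cast; rfl, Complex.ofReal_re]
  have h := kernel_formula hD N m (lam := lambdaParam d ζ) (b := b) (δ := deltaParam d ζ)
    (e := (ε : ℂ) / 2) hre hlam
    (by rw [Complex.add_re, hεre, hb]; linarith)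
    (by rw [Complex.add_re, Complex.add_re, hεre, hδre, Complex.one_re]; linarith)
    (by
      rw [two_mul, Complex.add_re, Complex.add_re, Complex.add_re, hεre, hδre, Complex.one_re]
      linarith) r s
  have hK : kernelK d N m (deltaParam d (ζ + ε)) ζ r s =
      1 / cesaroNumber (deltaParam d (ζ + ε)) N *
        (if m ≤ N then ∑ j ∈ Finset.range ((N - m) / 2 + 1),
          cesaroNumber (deltaParam d ζ + 2 * (ε / 2)) (N - m - 2 * j) * ((r * s : ℝ) : ℂ) ^ m *
            laguerreFun (lambdaParam d ζ + m) j r * laguerreFun (lambdaParam d ζ + m) j s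
        else 0) := by
    rw [kernelK, ← e2]
    split_ifs
    · rfl
    · rw [mul_zero]
  rw [weightedKernel, hK, h, e1]
  simp only [Finset.mul_sum]
  refine Finset.sum_congr rfl fun k _ => Finset.sum_congr rfl fun j _ => ?_
  ring

end CesaroHermite

end

theorem proposition4p4 (d : ℕ) (hd : 2 ≤ d) (p p' : ℝ) (hp : 2 < p) (hpp' : p.HolderConjugate p')
    (ε : ℝ) (hε : 0 < ε) (N m : ℕ) (β : ℝ) (r s : ℝ) (hr : 0 < r) (hs : 0 < s) :
    -- `σ_n^{δ,D}(r x', s y')` depends only on `r`, `s` and `u = x' ⬝ y'`, for `D = d, d + 1`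
    (∀ D ∈ ({d, d + 1} : Set ℕ), ∀ (δ : ℂ) (n : ℕ) (x' y' : EuclideanSpace ℝ (Fin D)),
      ‖x'‖ = 1 → ‖y'‖ = 1 →
        CesaroHermite.hermiteCesaroKernel D δ n (r • x') (s • y') =
          CesaroHermite.radialCesaroKernel D δ n r s (inner ℝ x' y')) ∧
    -- the functions `Q_m^{λ(ζ)}` are well defined, and the integrals below converge
    (∀ ζ ∈ ({(β : ℂ) * Complex.I, 1 / 2 + (β : ℂ) * Complex.I} : Set ℂ),
      ∀ u ∈ Set.Icc (-1 : ℝ) 1,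
        Filter.Tendsto (fun η => CesaroHermite.regQ m (CesaroHermite.lambdaParam d ζ) η u)
          (nhdsWithin 0 (Set.Ioi 0))
          (nhds (CesaroHermite.funQ m (CesaroHermite.lambdaParam d ζ) u))) ∧
    (∀ n : ℕ, IntervalIntegrable
      (fun u => CesaroHermite.radialCesaroKernel d
          (CesaroHermite.deltaParam d (β * Complex.I + ε / 2)) n r s u *
        CesaroHermite.funQ m (CesaroHermite.lambdaParam d (β * Complex.I)) u)
      MeasureTheory.volume (-1) 1) ∧
    (∀ n : ℕ, IntervalIntegrable
      (fun u => CesaroHermite.radialCesaroKernel (d + 1)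
          (CesaroHermite.deltaParam d (1 / 2 + β * Complex.I + ε / 2)) n r s u *
        CesaroHermite.funQ m (CesaroHermite.lambdaParam d (1 / 2 + β * Complex.I)) u)
      MeasureTheory.volume (-1) 1) ∧
    -- the formula for `ζ = i β`
    CesaroHermite.weightedKernel d p p' ε N m (β * Complex.I) r s =
      (CesaroHermite.constC d : ℂ) /
          CesaroHermite.cesaroNumber (CesaroHermite.deltaParam d (β * Complex.I + ε)) N *
        ∑ k ∈ Finset.range (N + 1), Ring.choose ((ε : ℂ) / 2) (N - k) *
          ∑ j ∈ Finset.range (k / 2 + 1),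
            CesaroHermite.cesaroNumber ((ε : ℂ) / 2 + β * Complex.I - 1) j *
            CesaroHermite.cesaroNumber
              (CesaroHermite.deltaParam d (β * Complex.I + ε / 2)) (k - 2 * j) *
            (r : ℂ) ^ (2 * CesaroHermite.deltaParam d (β * Complex.I) / (p : ℂ)) *
            (s : ℂ) ^ (2 * CesaroHermite.deltaParam d (β * Complex.I) / (p' : ℂ)) *
            ∫ u in (-1 : ℝ)..1,
              CesaroHermite.radialCesaroKernel d
                (CesaroHermite.deltaParam d (β * Complex.I + ε / 2)) (k - 2 * j) r s u *
              CesaroHermite.funQ m (CesaroHermite.lambdaParam d (β * Complex.I)) u ∧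
    -- the formula for `ζ = 1/2 + i β`
    CesaroHermite.weightedKernel d p p' ε N m (1 / 2 + β * Complex.I) r s =
      (CesaroHermite.constC (d + 1) : ℂ) /
          CesaroHermite.cesaroNumber (CesaroHermite.deltaParam d (1 / 2 + β * Complex.I + ε)) N *
        ∑ k ∈ Finset.range (N + 1), Ring.choose ((ε : ℂ) / 2) (N - k) *
          ∑ j ∈ Finset.range (k / 2 + 1),
            CesaroHermite.cesaroNumber ((ε : ℂ) / 2 + β * Complex.I - 1) j *
            CesaroHermite.cesaroNumber
              (CesaroHermite.deltaParam d (1 / 2 + β * Complex.I + ε / 2)) (k - 2 * j) *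
            (r : ℂ) ^ (2 * CesaroHermite.deltaParam d (1 / 2 + β * Complex.I) / (p : ℂ)) *
            (s : ℂ) ^ (2 * CesaroHermite.deltaParam d (1 / 2 + β * Complex.I) / (p' : ℂ)) *
            ∫ u in (-1 : ℝ)..1,
              CesaroHermite.radialCesaroKernel (d + 1)
                (CesaroHermite.deltaParam d (1 / 2 + β * Complex.I + ε / 2)) (k - 2 * j) r s u *
              CesaroHermite.funQ m (CesaroHermite.lambdaParam d (1 / 2 + β * Complex.I)) u := by
  have hζ : ∀ ζ ∈ ({(β : ℂ) * Complex.I, 1 / 2 + (β : ℂ) * Complex.I} : Set ℂ),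
      0 ≤ (CesaroHermite.lambdaParam d ζ).re := by
    have h2 : (2 : ℝ) ≤ d := by exact_mod_cast hd
    have h : ∀ ζ : ℂ, 0 ≤ ζ.re → 0 ≤ (CesaroHermite.lambdaParam d ζ).re := fun ζ h => by
      have e : CesaroHermite.lambdaParam d ζ = (((d : ℝ) / 2 - 1 : ℝ) : ℂ) + ζ := by
        rw [CesaroHermite.lambdaParam]
        push_cast
        ring
      rw [e, Complex.add_re, Complex.ofReal_re]
      linarith
    rintro ζ (rfl | rfl)
    · exact h _ (by simp)
    · exact h _ (by simp)
  have hβ : ((β : ℂ) * Complex.I).re = 0 := by simp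
  refine ⟨?_, ?_, ?_, ?_, ?_, ?_⟩
  · rintro D (rfl | rfl) δ n x' y' hx hy
    · exact CesaroHermite.hermiteCesaroKernel_eq_radial hd δ n r s hx hy
    · exact CesaroHermite.hermiteCesaroKernel_eq_radial (by omega) δ n r s hx hy
  · exact fun ζ h u hu => CesaroHermite.tendsto_regQ_funQ (hζ ζ h) m hu
  · exact fun n => CesaroHermite.intervalIntegrable_radialCesaroKernel_mul_funQ hd _ m n
      (hζ _ (Or.inl rfl)) r s
  · exact fun n => CesaroHermite.intervalIntegrable_radialCesaroKernel_mul_funQ (by omega) _ m n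
      (hζ _ (Or.inr rfl)) r s
  · exact CesaroHermite.weightedKernel_eq hd p p' hε N m hβ rfl r s
  · exact CesaroHermite.weightedKernel_eq (by omega) p p' hε N m hβ (by push_cast; ring) r s
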